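/- Let $n,m\ge 0$ be integers. For $p\ge 0$ let $\mathcal E'(S^p)$ be the space of compactly supported (real- or complex-valued) distributional symmetric $p$-tensor fields on $\mathbb R^n$, i.e. families $f=(f_{i_1\dots i_p})$, $1\le i_1,\dots,i_p\le n$, of elements of $\mathcal E'(\mathbb R^n)$ that are symmetric in the indices. For an integer $k\ge 0$ and $f\in\mathcal E'(S^p)$ the momentum ray transform $I^kf\in\mathcal D'(\mathbb R^n\times(\mathbb R^n\setminus\{0\}))$ is defined by $$\langle I^kf,\psi\rangle=\sum_{i_1,\dots,i_p=1}^n\Big\langle f_{i_1\dots i_p},\ \int_{\mathbb R^n}\int_{\mathbb R}t^k\,\xi^{i_1}\cdots\xi^{i_p}\,\psi(x-t\xi,\xi)\,dt\,d\xi\Big\rangle,\qquad \psi\in C_c^\infty(\mathbb R^n\times(\mathbb R^n\setminus\{0\})),$$ and for $F=(f^{(0)},\dots,f^{(m)})\in\bigoplus_{p=0}^m\mathcal E'(S^p)$ put $I^{m,k}F=\sum_{p=0}^mI^kf^{(p)}$. Let $P_r(\xi,\partial_\xi)=\sum_{i_1,\dots,i_r=1}^n\xi^{i_1}\cdots\xi^{i_r}\frac{\partial^r}{\partial\xi^{i_1}\cdots\partial\xi^{i_r}}$,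 and let $\sigma(i_1\dots i_j)$ denote symmetrization, i.e. the arithmetic mean over all permutations of the indices $i_1,\dots,i_j$. Theorem. (a) For every $F=(f^{(0)},\dots,f^{(m)})\in\bigoplus_{p=0}^m\mathcal E'(S^p)$, every $0\le j\le m$ and all indices $i_1,\dots,i_j\in\{1,\dots,n\}$, $$I^0\big(f^{(j)}_{i_1\dots i_j}\big)=\frac{(-1)^{m-j}}{(m-j)!\,j!}\,\sigma(i_1\dots i_j)\,P_{m-j}(\xi,\partial_\xi)\sum_{k=0}^j(-1)^k\binom jk\frac{\partial^j(I^{m,k}F)}{\partial x^{i_1}\cdots\partial x^{i_k}\,\partial\xi^{i_{k+1}}\cdots\partial\xi^{i_j}}$$ in the sense of distributions on $\mathbb R^n\times(\mathbb R^n\setminus\{0\})$, where on the left $I^0$ is applied to the scalar distribution $f^{(j)}_{i_1\dots i_j}\in\mathcal E'(\mathbb R^n)=\mathcal E'(S^0)$. (b) Let $n\ge 2$ and $0\le k<m$. If $I^{m,l}F=0$ for $l=0,1,\dots,k$, then $f^{(j)}=0$ for $j=0,1,\dots,k$. -/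

import Mathlib

open MeasureTheory TopologicalSpace
open scoped Distributions LineDeriv ContDiff

noncomputable section

namespace MomentumRay

/-- The Euclidean space `ℝⁿ`. -/
abbrev Rn (n : ℕ) : Type := EuclideanSpace ℝ (Fin n)

/-- The `i`-th vector of the standard basis of `ℝⁿ`. -/
def stdVec {n : ℕ} (i : Fin n) : Rn n := EuclideanSpace.single i 1

/-- The open set `ℝⁿ × (ℝⁿ ∖ {0})` of pairs `(x, ξ)`. -/
def phaseSpace (n : ℕ) : Opens (Rn n × Rn n) :=
  ⟨{p | p.2 ≠ 0}, isOpen_ne_fun continuous_snd continuous_const⟩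

/-- The space `C^∞(ℝⁿ)` of real-valued smooth functions. -/
def smoothFunctions (n : ℕ) : Submodule ℝ (Rn n → ℝ) where
  carrier := {φ | ContDiff ℝ ∞ φ}
  add_mem' := by
    intro a b (ha : ContDiff ℝ ∞ a) (hb : ContDiff ℝ ∞ b)
    exact ha.add hb
  zero_mem' := (contDiff_const : ContDiff ℝ ∞ fun _ : Rn n => (0 : ℝ))
  smul_mem' := by
    intro c a (ha : ContDiff ℝ ∞ a)
    exact ha.const_smul c

/-- The space `𝓔'(ℝⁿ)` of compactly supported (real or complex) distributions, as the dual of the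
Fréchet space `C^∞(ℝⁿ)`: linear functionals `u` for which there are a compact set `K`, an order `N`
and a constant `C` such that `|⟨u, φ⟩| ≤ C * M` whenever the derivatives of `φ` of order at most
`N` are bounded by `M` on `K`. As for Mathlib's `𝓓'(Ω, 𝕜)`, test functions are real-valued. -/
def compactDistributions (𝕜 : Type*) [RCLike 𝕜] (n : ℕ) :
    Submodule ℝ (smoothFunctions n →ₗ[ℝ] 𝕜) where
  carrier := {u | ∃ K : Set (Rn n), IsCompact K ∧ ∃ (N : ℕ) (C : ℝ),
    ∀ (φ : smoothFunctions n) (M : ℝ), 0 ≤ M →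
      (∀ l ≤ N, ∀ x ∈ K, ‖iteratedFDeriv ℝ l (φ : Rn n → ℝ) x‖ ≤ M) → ‖u φ‖ ≤ C * M}
  add_mem' := by
    rintro u v ⟨K, hK, N, C, h⟩ ⟨K', hK', N', C', h'⟩
    refine ⟨K ∪ K', hK.union hK', max N N', C + C', fun φ M hM hφ => ?_⟩
    have h1 := h φ M hM fun l hl x hx => hφ l (hl.trans (le_max_left _ _)) x (Or.inl hx)
    have h2 := h' φ M hM fun l hl x hx => hφ l (hl.trans (le_max_right _ _)) x (Or.inr hx)
    calc ‖(u + v) φ‖ ≤ ‖u φ‖ + ‖v φ‖ := norm_add_le _ _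
      _ ≤ (C + C') * M := by linarith
  zero_mem' := ⟨∅, isCompact_empty, 0, 0, fun φ M _ _ => by simp⟩
  smul_mem' := by
    rintro c u ⟨K, hK, N, C, h⟩
    refine ⟨K, hK, N, |c| * C, fun φ M hM hφ => ?_⟩
    have h1 := h φ M hM hφ
    calc ‖(c • u) φ‖ = |c| * ‖u φ‖ := by simp [norm_smul]
      _ ≤ |c| * (C * M) := by gcongr
      _ = |c| * C * M := by ring

/-- The space `𝓔'(S^p)` of compactly supported distributional symmetric `p`-tensor fields, given
by their components `f_{i₁…i_p}`, symmetric in the indices. -/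
def symTensors (𝕜 : Type*) [RCLike 𝕜] (n p : ℕ) :
    Submodule ℝ ((Fin p → Fin n) → compactDistributions 𝕜 n) where
  carrier := {f | ∀ (π : Equiv.Perm (Fin p)) (i : Fin p → Fin n), f (i ∘ π) = f i}
  add_mem' := fun ha hb π i => by simp [ha π i, hb π i]
  zero_mem' := fun _ _ => rfl
  smul_mem' := fun c _ h π i => by simp [h π i]

/-- The space `𝓔'(S⁰) ⊕ 𝓔'(S¹) ⊕ ⋯ ⊕ 𝓔'(S^m)`, with elements `F = (f⁽⁰⁾, …, f⁽ᵐ⁾)`. -/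
abbrev TensorSums (𝕜 : Type*) [RCLike 𝕜] (n m : ℕ) : Type _ :=
  (p : Fin (m + 1)) → symTensors 𝕜 n p

/-- The monomial `ξ^{i₁} ⋯ ξ^{i_p}`. -/
def monomial {n p : ℕ} (i : Fin p → Fin n) (ξ : Rn n) : ℝ := ∏ s, ξ (i s)

/-- `x ↦ ∫_{ℝⁿ} ∫_ℝ t^k w(ξ) ψ(x - tξ, ξ) dt dξ`. -/
def backProj {n : ℕ} {F : Type} [NormedAddCommGroup F] [NormedSpace ℝ F]
    (k : ℕ) (w : Rn n → ℝ) (ψ : Rn n × Rn n → F) (x : Rn n) : F :=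
  ∫ ξ : Rn n, ∫ t : ℝ, (t ^ k * w ξ) • ψ (x - t • ξ, ξ)

section Smoothness

variable {n : ℕ} {F : Type} [NormedAddCommGroup F] [NormedSpace ℝ F]

lemma exists_box {K : Set (Rn n × Rn n)} (hK : IsCompact K) (hΩ : K ⊆ phaseSpace n) (R : ℝ) :
    ∃ B : Set (Rn n × ℝ), IsCompact B ∧
      ∀ x : Rn n, ‖x‖ ≤ R → ∀ ξ t, (x - t • ξ, ξ) ∈ K → (ξ, t) ∈ B := by
  have hne : ∀ p ∈ K, p.2 ≠ 0 := fun p hp => hΩ hp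
  have hpos : ∀ p ∈ K, (0 : ℝ) < ‖p.2‖ := fun p hp => norm_pos_iff.2 (hne p hp)
  have hcont : ContinuousOn (fun p : Rn n × Rn n => ‖p.2‖) K := continuous_snd.norm.continuousOn
  obtain ⟨δ, hδ, hδK⟩ := hK.exists_forall_le' hcont hpos
  obtain ⟨M, hM⟩ := hK.isBounded.exists_norm_le
  refine ⟨Metric.closedBall 0 M ×ˢ Metric.closedBall 0 ((R + M) / δ),
    (isCompact_closedBall _ _).prod (isCompact_closedBall _ _), fun x hx ξ t h => ?_⟩
  have h1 := hM _ h
  rw [Prod.norm_mk, max_le_iff] at h1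
  obtain ⟨h3, h2⟩ := h1
  have h4 := hδK _ h
  have h5 : ‖t • ξ‖ ≤ R + M := by
    calc ‖t • ξ‖ = ‖x - (x - t • ξ)‖ := by rw [sub_sub_cancel]
      _ ≤ ‖x‖ + ‖x - t • ξ‖ := norm_sub_le _ _
      _ ≤ R + M := add_le_add hx h3
  rw [norm_smul] at h5
  refine Set.mk_mem_prod (mem_closedBall_zero_iff.2 h2) (mem_closedBall_zero_iff.2 ?_)
  rw [le_div_iff₀ hδ]
  exact (mul_le_mul_of_nonneg_left h4 (norm_nonneg _)).trans h5

lemma integrable_kernel {K : Set (Rn n × Rn n)} (hK : IsCompact K) (hΩ : K ⊆ phaseSpace n)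
    (k : ℕ) {w : Rn n → ℝ} (hw : Continuous w) {ψ : Rn n × Rn n → F} (hψ : Continuous ψ)
    (h0 : ∀ p ∉ K, ψ p = 0) (x : Rn n) :
    Integrable (fun q : Rn n × ℝ => (q.2 ^ k * w q.1) • ψ (x - q.2 • q.1, q.1)) := by
  obtain ⟨B, hB, hBx⟩ := exists_box hK hΩ ‖x‖
  apply Continuous.integrable_of_hasCompactSupport
  · fun_prop
  · refine HasCompactSupport.intro hB fun q hq => ?_
    rw [h0 _ fun h => hq (hBx x le_rfl _ _ h), smul_zero]

lemma backProj_eq {K : Set (Rn n × Rn n)} (hK : IsCompact K) (hΩ : K ⊆ phaseSpace n)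
    (k : ℕ) {w : Rn n → ℝ} (hw : Continuous w) {ψ : Rn n × Rn n → F} (hψ : Continuous ψ)
    (h0 : ∀ p ∉ K, ψ p = 0) (x : Rn n) :
    backProj k w ψ x = ∫ q : Rn n × ℝ, (q.2 ^ k * w q.1) • ψ (x - q.2 • q.1, q.1) := by
  rw [Measure.volume_eq_prod, integral_prod]
  · rfl
  · exact integrable_kernel hK hΩ k hw hψ h0 x

lemma backProj_bound {K : Set (Rn n × Rn n)} (hK : IsCompact K) (hΩ : K ⊆ phaseSpace n)
    (k : ℕ) {w : Rn n → ℝ} (hw : Continuous w) (R : ℝ) :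
    ∃ C : ℝ, 0 ≤ C ∧ ∀ {F : Type} [NormedAddCommGroup F] [NormedSpace ℝ F]
      {ψ : Rn n × Rn n → F}, Continuous ψ → (∀ p ∉ K, ψ p = 0) →
      ∀ M : ℝ, 0 ≤ M → (∀ p, ‖ψ p‖ ≤ M) → ∀ x, ‖x‖ ≤ R → ‖backProj k w ψ x‖ ≤ C * M := by
  obtain ⟨B, hB, hBx⟩ := exists_box hK hΩ R
  obtain ⟨A, hA⟩ := hB.exists_bound_of_continuousOn
    (f := fun q : Rn n × ℝ => q.2 ^ k * w q.1) (by fun_prop)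
  refine ⟨|A| * (volume B).toReal, by positivity, ?_⟩
  intro F _ _ ψ hψ h0 M hM hψM x hx
  rw [backProj_eq hK hΩ k hw hψ h0, ← setIntegral_eq_integral_of_forall_compl_eq_zero (s := B)]
  · calc _ ≤ (|A| * M) * (volume B).toReal := by
          refine norm_setIntegral_le_of_norm_le_const hB.measure_lt_top fun q hq => ?_
          rw [norm_smul]
          exact mul_le_mul ((hA q hq).trans (le_abs_self A)) (hψM _) (norm_nonneg _) (abs_nonneg _)
      _ = _ := by ring
  · intro q hq
    rw [h0 _ fun h => hq (hBx x hx _ _ h), smul_zero]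

/-- The partial derivative of `ψ(x, ξ)` with respect to `x`. -/
def xDeriv (ψ : Rn n × Rn n → F) (p : Rn n × Rn n) : Rn n →L[ℝ] F :=
  (fderiv ℝ ψ p).comp (ContinuousLinearMap.inl ℝ (Rn n) (Rn n))

lemma xDeriv_contDiff {ψ : Rn n × Rn n → F} (hψ : ContDiff ℝ ∞ ψ) : ContDiff ℝ ∞ (xDeriv ψ) :=
  (hψ.fderiv_right (m := ∞) (by simp)).clm_comp contDiff_const

lemma xDeriv_zero {K : Set (Rn n × Rn n)} (hK : IsCompact K) {ψ : Rn n × Rn n → F}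
    (h0 : ∀ p ∉ K, ψ p = 0) : ∀ p ∉ K, xDeriv ψ p = 0 := by
  intro p hp
  have : ψ =ᶠ[nhds p] fun _ => 0 := by
    filter_upwards [hK.isClosed.isOpen_compl.mem_nhds hp] with q hq using h0 q hq
  rw [xDeriv, this.fderiv_eq]
  simp

lemma xDeriv_bound {ψ : Rn n × Rn n → F} (hψ : ContDiff ℝ ∞ ψ) {N : ℕ} {M : ℝ}
    (h : ∀ p, ‖iteratedFDeriv ℝ (N + 1) ψ p‖ ≤ M) (p : Rn n × Rn n) :
    ‖iteratedFDeriv ℝ N (xDeriv ψ) p‖ ≤ M := by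
  set T : ((Rn n × Rn n) →L[ℝ] F) →L[ℝ] (Rn n →L[ℝ] F) :=
    (ContinuousLinearMap.inl ℝ (Rn n) (Rn n)).precomp F
  have hT : ‖T‖ ≤ 1 := by
    refine ContinuousLinearMap.opNorm_le_bound _ zero_le_one fun g => ?_
    calc ‖T g‖ ≤ ‖g‖ * ‖ContinuousLinearMap.inl ℝ (Rn n) (Rn n)‖ :=
          ContinuousLinearMap.opNorm_comp_le _ _
      _ ≤ ‖g‖ * 1 := by gcongr; exact ContinuousLinearMap.norm_inl_le_one _ _ _
      _ = 1 * ‖g‖ := by ring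
  have hd : ContDiff ℝ ∞ (fderiv ℝ ψ) := hψ.fderiv_right (m := ∞) (by simp)
  have e : xDeriv ψ = T ∘ fderiv ℝ ψ := rfl
  calc ‖iteratedFDeriv ℝ N (xDeriv ψ) p‖
      = ‖T.compContinuousMultilinearMap (iteratedFDeriv ℝ N (fderiv ℝ ψ) p)‖ := by
        rw [e, T.iteratedFDeriv_comp_left hd.contDiffAt (by exact_mod_cast le_top)]
    _ ≤ ‖T‖ * ‖iteratedFDeriv ℝ N (fderiv ℝ ψ) p‖ := T.norm_compContinuousMultilinearMap_le _
    _ ≤ 1 * M := by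
        rw [norm_iteratedFDeriv_fderiv]
        exact mul_le_mul hT (h p) (norm_nonneg _) zero_le_one
    _ = M := one_mul M

lemma backProj_hasFDerivAt {K : Set (Rn n × Rn n)} (hK : IsCompact K) (hΩ : K ⊆ phaseSpace n)
    (k : ℕ) {w : Rn n → ℝ} (hw : Continuous w) {ψ : Rn n × Rn n → F} (hψ : ContDiff ℝ ∞ ψ)
    (h0 : ∀ p ∉ K, ψ p = 0) (x : Rn n) :
    HasFDerivAt (backProj k w ψ) (backProj k w (xDeriv ψ) x) x := by
  have hψ' := (xDeriv_contDiff hψ).continuous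
  have h0' := xDeriv_zero hK h0
  rw [backProj_eq hK hΩ k hw hψ' h0', funext (backProj_eq hK hΩ k hw hψ.continuous h0)]
  obtain ⟨B, hB, hBx⟩ := exists_box hK hΩ (‖x‖ + 1)
  obtain ⟨A, hA⟩ := hB.exists_bound_of_continuousOn
    (f := fun q : Rn n × ℝ => q.2 ^ k * w q.1) (by fun_prop)
  obtain ⟨D, hD⟩ := hψ'.bounded_above_of_compact_support (HasCompactSupport.intro hK h0')
  refine hasFDerivAt_integral_of_dominated_of_fderiv_le (s := Metric.ball x 1)
    (bound := B.indicator fun _ => |A| * D)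
    (F' := fun y q => (q.2 ^ k * w q.1) • xDeriv ψ (y - q.2 • q.1, q.1))
    (Metric.ball_mem_nhds x one_pos) ?_ ?_ ?_ ?_ ?_ ?_
  · exact .of_forall fun y => (integrable_kernel hK hΩ k hw hψ.continuous h0 y).1
  · exact integrable_kernel hK hΩ k hw hψ.continuous h0 x
  · exact (integrable_kernel hK hΩ k hw hψ' h0' x).1
  · refine .of_forall fun q y hy => ?_
    have hy' : ‖y‖ ≤ ‖x‖ + 1 := by
      have := norm_le_norm_add_norm_sub' y x
      rw [mem_ball_iff_norm] at hy
      linarith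
    by_cases hq : q ∈ B
    · rw [Set.indicator_of_mem hq, norm_smul]
      exact mul_le_mul ((hA q hq).trans (le_abs_self A)) (hD _) (norm_nonneg _) (abs_nonneg _)
    · rw [Set.indicator_of_notMem hq, h0' _ fun h => hq (hBx y hy' _ _ h), smul_zero, norm_zero]
  · rw [integrable_indicator_iff hB.measurableSet]
    exact integrableOn_const hB.measure_lt_top.ne
  · refine .of_forall fun q y _ => ?_
    have h1 : HasFDerivAt ψ (fderiv ℝ ψ (y - q.2 • q.1, q.1)) (y - q.2 • q.1, q.1) :=
      (hψ.differentiable (by simp) _).hasFDerivAt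
    have h2 : HasFDerivAt (fun y : Rn n => (y - q.2 • q.1, q.1))
        (ContinuousLinearMap.inl ℝ (Rn n) (Rn n)) y :=
      ((hasFDerivAt_id y).sub_const _).prodMk (hasFDerivAt_const q.1 y)
    exact (h1.comp y h2).const_smul _

lemma backProj_contDiff_nat {K : Set (Rn n × Rn n)} (hK : IsCompact K) (hΩ : K ⊆ phaseSpace n)
    (k : ℕ) {w : Rn n → ℝ} (hw : Continuous w) (N : ℕ) :
    ∀ {F : Type} [NormedAddCommGroup F] [NormedSpace ℝ F] {ψ : Rn n × Rn n → F},
      ContDiff ℝ ∞ ψ → (∀ p ∉ K, ψ p = 0) → ContDiff ℝ N (backProj k w ψ) := by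
  induction N with
  | zero =>
    intro F _ _ ψ hψ h0
    exact contDiff_zero.2 (continuous_iff_continuousAt.2 fun x =>
      (backProj_hasFDerivAt hK hΩ k hw hψ h0 x).continuousAt)
  | succ N ih =>
    intro F _ _ ψ hψ h0
    exact contDiff_succ_iff_hasFDerivAt.2
      ⟨_, ih (xDeriv_contDiff hψ) (xDeriv_zero hK h0), backProj_hasFDerivAt hK hΩ k hw hψ h0⟩

lemma backProj_iteratedFDeriv_bound {K : Set (Rn n × Rn n)} (hK : IsCompact K)
    (hΩ : K ⊆ phaseSpace n) (k : ℕ) {w : Rn n → ℝ} (hw : Continuous w) (R : ℝ) :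
    ∃ C : ℝ, 0 ≤ C ∧ ∀ (N : ℕ) {F : Type} [NormedAddCommGroup F] [NormedSpace ℝ F]
      {ψ : Rn n × Rn n → F}, ContDiff ℝ ∞ ψ → (∀ p ∉ K, ψ p = 0) →
      ∀ M : ℝ, 0 ≤ M → (∀ p, ‖iteratedFDeriv ℝ N ψ p‖ ≤ M) →
      ∀ x, ‖x‖ ≤ R → ‖iteratedFDeriv ℝ N (backProj k w ψ) x‖ ≤ C * M := by
  obtain ⟨C, hC, h⟩ := backProj_bound hK hΩ k hw R
  refine ⟨C, hC, fun N => ?_⟩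
  induction N with
  | zero =>
    intro F _ _ ψ hψ h0 M hM hψM x hx
    simp only [norm_iteratedFDeriv_zero] at hψM ⊢
    exact h hψ.continuous h0 M hM hψM x hx
  | succ N ih =>
    intro F _ _ ψ hψ h0 M hM hψM x hx
    rw [← norm_iteratedFDeriv_fderiv,
      funext fun y => (backProj_hasFDerivAt hK hΩ k hw hψ h0 y).fderiv]
    exact ih (xDeriv_contDiff hψ) (xDeriv_zero hK h0) M hM (xDeriv_bound hψ hψM) x hx

lemma monomial_contDiff {p : ℕ} (i : Fin p → Fin n) : ContDiff ℝ ∞ (monomial i) := by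
  unfold monomial
  fun_prop

end Smoothness

/-- The `i`-component `[(I^k)^* ψ]_{i₁…i_p}(x) = ∫_{ℝⁿ} ∫_ℝ t^k ξ^{i₁}⋯ξ^{i_p} ψ(x - tξ, ξ) dt dξ`
of the adjoint of the `k`-th momentum ray transform on `p`-tensors, for
`ψ ∈ C_c^∞(ℝⁿ × (ℝⁿ ∖ {0}))`. It is a smooth function of `x`. -/
def adjoint {n p : ℕ} (k : ℕ) (i : Fin p → Fin n) (ψ : 𝓓(phaseSpace n, ℝ)) : smoothFunctions n :=
  ⟨fun x => ∫ ξ : Rn n, ∫ t : ℝ, t ^ k * monomial i ξ * ψ (x - t • ξ, ξ),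
    contDiff_infty.2 fun N => backProj_contDiff_nat ψ.hasCompactSupport ψ.tsupport_subset k
      (monomial_contDiff i).continuous N ψ.contDiff fun _ => image_eq_zero_of_notMem_tsupport⟩

section Continuity

variable {𝕜 : Type*} [RCLike 𝕜] {n p : ℕ}

lemma adjoint_coe (k : ℕ) (i : Fin p → Fin n) (ψ : 𝓓(phaseSpace n, ℝ)) :
    (adjoint k i ψ : Rn n → ℝ) = backProj k (monomial i) ψ := rfl

lemma adjoint_add (k : ℕ) (i : Fin p → Fin n) (ψ χ : 𝓓(phaseSpace n, ℝ)) :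
    adjoint k i (ψ + χ) = adjoint k i ψ + adjoint k i χ := by
  have hw := (monomial_contDiff i).continuous
  have h (ψ : 𝓓(phaseSpace n, ℝ)) (x : Rn n) := backProj_eq ψ.hasCompactSupport ψ.tsupport_subset k
    hw ψ.continuous (fun _ => image_eq_zero_of_notMem_tsupport) x
  have h' (ψ : 𝓓(phaseSpace n, ℝ)) (x : Rn n) := integrable_kernel ψ.hasCompactSupport
    ψ.tsupport_subset k hw ψ.continuous (fun _ => image_eq_zero_of_notMem_tsupport) x
  ext x
  change backProj k (monomial i) (ψ + χ : 𝓓(phaseSpace n, ℝ)) x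
    = backProj k (monomial i) ψ x + backProj k (monomial i) χ x
  rw [h, h, h, ← integral_add (h' ψ x) (h' χ x)]
  simp [mul_add]

lemma adjoint_smul (k : ℕ) (i : Fin p → Fin n) (c : ℝ) (ψ : 𝓓(phaseSpace n, ℝ)) :
    adjoint k i (c • ψ) = c • adjoint k i ψ := by
  ext x
  change backProj k (monomial i) (c • ψ : 𝓓(phaseSpace n, ℝ)) x = c • backProj k (monomial i) ψ x
  simp only [backProj]
  rw [← integral_smul]
  congr 1; ext ξ
  rw [← integral_smul]
  congr 1; ext t
  change t ^ k * monomial i ξ * (c * ψ (x - t • ξ, ξ))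
    = c * (t ^ k * monomial i ξ * ψ (x - t • ξ, ξ))
  ring

lemma continuous_adjoint (k : ℕ) (i : Fin p → Fin n) (u : compactDistributions 𝕜 n)
    (K : Compacts (Rn n × Rn n)) (hK : (K : Set (Rn n × Rn n)) ⊆ phaseSpace n) :
    Continuous fun ψ : 𝓓_{K}(Rn n × Rn n, ℝ) =>
      u.1 (adjoint k i (TestFunction.ofSupportedIn hK ψ)) := by
  obtain ⟨L, hL, N, C, hC⟩ := u.2
  obtain ⟨R, hR⟩ := hL.isBounded.exists_norm_le
  obtain ⟨C', hC', h⟩ := backProj_iteratedFDeriv_bound K.isCompact hK k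
    (monomial_contDiff i).continuous R
  refine (ContDiffMapSupportedIn.mkCLMtoNormedSpace ℝ
    (fun ψ : 𝓓_{K}(Rn n × Rn n, ℝ) => u.1 (adjoint k i (TestFunction.ofSupportedIn hK ψ)))
    ?_ ?_ ⟨Finset.Iic N, |C| * C', by positivity, ?_⟩).continuous
  · intro ψ χ
    rw [← map_add, ← adjoint_add]; rfl
  · intro c ψ
    rw [← map_smul, ← adjoint_smul]; rfl
  · intro ψ
    set S := (Finset.Iic N).sup (fun l => N[ℝ]_{K, l}) ψ
    have hS : 0 ≤ S := apply_nonneg _ _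
    calc _ ≤ C * (C' * S) := by
          refine hC _ _ (by positivity) fun l hl x hx => ?_
          refine h l ψ.contDiff (fun q hq => ψ.zero_on_compl hq) S hS (fun q => ?_) x (hR x hx)
          exact (ContDiffMapSupportedIn.norm_iteratedFDeriv_apply_le_seminorm_top ℝ).trans
            (Seminorm.le_finset_sup_apply (Finset.mem_Iic.2 hl))
      _ ≤ |C| * (C' * S) := by gcongr; exact le_abs_self C
      _ = |C| * C' * S := by ring

end Continuity

section Transforms

variable {𝕜 : Type*} [RCLike 𝕜] {n : ℕ}

/-- The distribution `ψ ↦ ⟨u, [(I^k)^* ψ]_{i₁…i_p}⟩` on `ℝⁿ × (ℝⁿ ∖ {0})`. -/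
def componentTransform {p : ℕ} (k : ℕ) (i : Fin p → Fin n) (u : compactDistributions 𝕜 n) :
    𝓓'(phaseSpace n, 𝕜) :=
  TestFunction.mkCLM ℝ (fun ψ => u.1 (adjoint k i ψ))
    (fun ψ χ => by rw [adjoint_add, map_add]) (fun c ψ => by rw [adjoint_smul, map_smul])
    (fun K hK => continuous_adjoint k i u K hK)

/-- The `k`-th momentum ray transform `I^k f ∈ 𝓓'(ℝⁿ × (ℝⁿ ∖ {0}))` of `f ∈ 𝓔'(S^p)`:
`⟨I^k f, ψ⟩ = ⟨f, (I^k)^* ψ⟩ = ∑_{i₁…i_p} ⟨f_{i₁…i_p}, [(I^k)^* ψ]_{i₁…i_p}⟩`. -/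
def momentRay {p : ℕ} (k : ℕ) (f : symTensors 𝕜 n p) : 𝓓'(phaseSpace n, 𝕜) :=
  ∑ i : Fin p → Fin n, componentTransform k i (f.1 i)

/-- The generalized momentum ray transform `I^{m,k} F = ∑_{p ≤ m} I^k f⁽ᵖ⁾`. -/
def genMomentRay {m : ℕ} (k : ℕ) (F : TensorSums 𝕜 n m) : 𝓓'(phaseSpace n, 𝕜) :=
  ∑ p : Fin (m + 1), momentRay k (F p)

/-- A compactly supported scalar distribution as a tensor field of rank `0`. -/
def scalarTensor (u : compactDistributions 𝕜 n) : symTensors 𝕜 n 0 :=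
  ⟨fun _ => u, fun _ _ => rfl⟩

/-- Multiplication of test functions by a smooth function. -/
def mulTest (g : Rn n × Rn n → ℝ) (hg : ContDiff ℝ ∞ g) :
    𝓓(phaseSpace n, ℝ) →L[ℝ] 𝓓(phaseSpace n, ℝ) :=
  TestFunction.limitCLM ℝ
    (fun ψ => ⟨fun q => ψ q * g q, ψ.contDiff.mul hg, ψ.hasCompactSupport.mul_right,
      (tsupport_mul_subset_left).trans ψ.tsupport_subset⟩)
    (fun _ hK => TestFunction.ofSupportedInCLM ℝ hK ∘L
      ContDiffMapSupportedIn.bilinLeftCLM (ContinuousLinearMap.mul ℝ ℝ) hg)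
    (fun _ _ _ => rfl)

/-- The product `g T` of a distribution with a smooth function, `⟨g T, ψ⟩ = ⟨T, g ψ⟩`. -/
def smoothMul (g : Rn n × Rn n → ℝ) (hg : ContDiff ℝ ∞ g) (T : 𝓓'(phaseSpace n, 𝕜)) :
    𝓓'(phaseSpace n, 𝕜) :=
  (mulTest g hg).precompCompactConvergenceCLM 𝕜 T

/-- The operator `P_r(ξ, ∂_ξ) = ξ^{i₁} ⋯ ξ^{i_r} ∂^r / ∂ξ^{i₁} ⋯ ∂ξ^{i_r}` on distributions, with
summation over `i₁, …, i_r`. -/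
def eulerOp (r : ℕ) (T : 𝓓'(phaseSpace n, 𝕜)) : 𝓓'(phaseSpace n, 𝕜) :=
  ∑ i : Fin r → Fin n, smoothMul (fun q => monomial i q.2)
    ((monomial_contDiff i).comp contDiff_snd) (∂^{fun s => ((0 : Rn n), stdVec (i s))} T)

/-- The mixed derivative `∂^j T / ∂x^{i₁} ⋯ ∂x^{i_k} ∂ξ^{i_{k+1}} ⋯ ∂ξ^{i_j}`. -/
def mixedDeriv {j : ℕ} (k : ℕ) (i : Fin j → Fin n) (T : 𝓓'(phaseSpace n, 𝕜)) :
    𝓓'(phaseSpace n, 𝕜) :=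
  ∂^{fun s : Fin j =>
    if (s : ℕ) < k then (stdVec (i s), (0 : Rn n)) else ((0 : Rn n), stdVec (i s))} T

/-- The symmetrization `σ(i₁ … i_j)`: the mean over all permutations of the indices. -/
def symmetrize {j : ℕ} (A : (Fin j → Fin n) → 𝓓'(phaseSpace n, 𝕜)) (i : Fin j → Fin n) :
    𝓓'(phaseSpace n, 𝕜) :=
  ((j.factorial : ℝ)⁻¹) • ∑ π : Equiv.Perm (Fin j), A (i ∘ π)

end Transforms

end MomentumRay

end

open MomentumRay

/-!
The operator `(∂/∂ξ^a) I^k - (∂/∂x^a) I^{k+1}` annihilates functions, so on `p`-tensors it only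
differentiates the weight `ξ^{i₁}⋯ξ^{i_p}`: it sends `f` to `p I^k f_a`, where `f_a` is `f` with one
index fixed to `a`. The alternating sum in the reconstruction formula is, after symmetrization, a
`j`-fold composition of such operators. It therefore kills tensors of rank below `j`, turns a tensor
of rank `j` into `j!` times the transform of its components, and turns a tensor of rank `p > j` into
transforms of tensors of rank `p - j`. On `I^0` of `q`-tensors, which is homogeneous of degree
`q - 1` in `ξ`, the operator `P_r` is multiplication by `(q - 1)(q - 2)⋯(q - r)`. This vanishes for
`1 ≤ q ≤ r` and equals `(-1)^r r!` for `q = 0`, so `P_{m-j}` isolates the component of rank `j`.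

The vanishing statement reduces in this way to the injectivity of `I^0` on functions. For `n ≥ 2`
every plane wave is constant along some line direction; a distribution with vanishing transform
annihilates such waves, hence all plane waves, and is zero by Fourier inversion.
-/

noncomputable section

namespace MomentumRay

section DistributionAlgebra

variable {E : Type*} [NormedAddCommGroup E] [NormedSpace ℝ E] {Ω : Opens E}

lemma testFunction_lineDerivOp_apply (v : E) (ψ : 𝓓(Ω, ℝ)) (q : E) :
    (∂_{v} ψ : 𝓓(Ω, ℝ)) q = fderiv ℝ ψ q v := by
  change (TestFunction.lineDerivCLM ℝ v ψ : 𝓓(Ω, ℝ)) q = _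
  rw [TestFunction.lineDerivCLM_eq_fderivCLM, TestFunction.fderivCLM_apply_of_le _ (by simp)]

lemma testFunction_lineDerivOp_comm (v w : E) (ψ : 𝓓(Ω, ℝ)) :
    ∂_{v} (∂_{w} ψ) = ∂_{w} (∂_{v} ψ) := by
  have hd : Differentiable ℝ (fderiv ℝ ψ) :=
    (ψ.contDiff.fderiv_right (m := ∞) (by simp)).differentiable (by simp)
  have lineDerivOp_lineDerivOp (v w : E) (q : E) :
      (∂_{v} (∂_{w} ψ) : 𝓓(Ω, ℝ)) q = fderiv ℝ (fderiv ℝ ψ) q v w := by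
    rw [testFunction_lineDerivOp_apply, funext (testFunction_lineDerivOp_apply w ψ),
      fderiv_clm_apply (hd q) (differentiableAt_const w)]
    simp
  have hsymm (q : E) : IsSymmSndFDerivAt ℝ ψ q :=
    ψ.contDiff.contDiffAt.isSymmSndFDerivAt (by
      rw [minSmoothness_of_isRCLikeNormedField]
      exact WithTop.coe_le_coe.2 le_top)
  ext q
  rw [lineDerivOp_lineDerivOp, lineDerivOp_lineDerivOp, (hsymm q).eq v w]

variable {𝕜 : Type*} [RCLike 𝕜]

lemma lineDerivOp_comm (v w : E) (T : 𝓓'(Ω, 𝕜)) : ∂_{v} (∂_{w} T) = ∂_{w} (∂_{v} T) := by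
  ext ψ
  simp only [Distribution.lineDerivOp_apply_apply, LineDeriv.lineDerivOp_neg, neg_neg]
  rw [testFunction_lineDerivOp_comm]

lemma lineDerivOp_iteratedLineDerivOp_comm (v : E) {r : ℕ} (m : Fin r → E) (T : 𝓓'(Ω, 𝕜)) :
    ∂_{v} (∂^{m} T) = ∂^{m} (∂_{v} T) := by
  induction r with
  | zero => rfl
  | succ r ih =>
    rw [LineDeriv.iteratedLineDerivOp_succ_left, LineDeriv.iteratedLineDerivOp_succ_left,
      lineDerivOp_comm, ih]

end DistributionAlgebra

section SmoothMultiplication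

variable {𝕜 : Type*} [RCLike 𝕜] {n : ℕ}

lemma contDiff_fderiv_apply {g : Rn n × Rn n → ℝ} (hg : ContDiff ℝ ∞ g) (v : Rn n × Rn n) :
    ContDiff ℝ ∞ fun q => fderiv ℝ g q v :=
  (hg.fderiv_right (m := ∞) (by simp)).clm_apply contDiff_const

lemma smoothMul_const (c : ℝ) (T : 𝓓'(phaseSpace n, 𝕜)) :
    smoothMul (fun _ => c) contDiff_const T = c • T := by
  ext ψ
  have h : mulTest (fun _ => c) contDiff_const ψ = c • ψ := TestFunction.ext fun q => mul_comm _ _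
  change T (mulTest _ _ ψ) = c • T ψ
  rw [h, map_smul]

lemma lineDerivOp_smoothMul {g : Rn n × Rn n → ℝ} (hg : ContDiff ℝ ∞ g) (v : Rn n × Rn n)
    (T : 𝓓'(phaseSpace n, 𝕜)) :
    ∂_{v} (smoothMul g hg T) = smoothMul g hg (∂_{v} T) +
      smoothMul (fun q => fderiv ℝ g q v) (contDiff_fderiv_apply hg v) T := by
  have leibniz (ψ : 𝓓(phaseSpace n, ℝ)) : ∂_{v} (mulTest g hg ψ) =
      mulTest g hg (∂_{v} ψ) + mulTest _ (contDiff_fderiv_apply hg v) ψ := by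
    ext q
    have h := (ψ.contDiff.differentiable (by simp) q).hasFDerivAt.mul
      (hg.differentiable (by simp) q).hasFDerivAt
    change (∂_{v} (mulTest g hg ψ) : 𝓓(phaseSpace n, ℝ)) q =
      (∂_{v} ψ : 𝓓(phaseSpace n, ℝ)) q * g q + ψ q * fderiv ℝ g q v
    rw [testFunction_lineDerivOp_apply, testFunction_lineDerivOp_apply]
    change fderiv ℝ (⇑ψ * g) q v = _
    rw [h.fderiv]
    simp only [add_apply, smul_apply, smul_eq_mul]
    ring
  ext ψ
  change -T (mulTest g hg (∂_{v} ψ)) = -T (∂_{v} (mulTest g hg ψ)) + T (mulTest _ _ ψ)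
  rw [leibniz, map_add]
  ring

end SmoothMultiplication

section Euler

variable {𝕜 : Type*} [RCLike 𝕜] {n : ℕ}

/-- The direction of `∂/∂x^a` in phase space. -/
abbrev xDir (a : Fin n) : Rn n × Rn n := (stdVec a, 0)

/-- The direction of `∂/∂ξ^a` in phase space. -/
abbrev xiDir (a : Fin n) : Rn n × Rn n := (0, stdVec a)

/-- Multiplication of distributions by the coordinate `ξ^a`. -/
def xiMul (a : Fin n) : 𝓓'(phaseSpace n, 𝕜) →L[ℝ] 𝓓'(phaseSpace n, 𝕜) :=
  (mulTest (fun q => q.2 a) (by fun_prop)).precompCompactConvergenceCLM 𝕜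

lemma fderiv_xi (a : Fin n) (q v : Rn n × Rn n) :
    fderiv ℝ (fun q : Rn n × Rn n => q.2 a) q v = v.2 a :=
  congrArg (· v) ((EuclideanSpace.proj a : Rn n →L[ℝ] ℝ).comp
    (ContinuousLinearMap.snd ℝ (Rn n) (Rn n))).hasFDerivAt.fderiv

lemma xiMul_comm (a b : Fin n) (T : 𝓓'(phaseSpace n, 𝕜)) :
    xiMul a (xiMul b T) = xiMul b (xiMul a T) := by
  ext ψ
  exact congrArg T (TestFunction.ext fun q => mul_right_comm _ _ _)

lemma lineDerivOp_xiMul (a : Fin n) (v : Rn n × Rn n) (T : 𝓓'(phaseSpace n, 𝕜)) :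
    ∂_{v} (xiMul a T) = xiMul a (∂_{v} T) + v.2 a • T := by
  have h := lineDerivOp_smoothMul (g := fun q : Rn n × Rn n => q.2 a) (by fun_prop) v T
  simp only [fderiv_xi, smoothMul_const] at h
  exact h

lemma lineDerivOp_xDir_xiMul (a b : Fin n) (T : 𝓓'(phaseSpace n, 𝕜)) :
    ∂_{xDir b} (xiMul a T) = xiMul a (∂_{xDir b} T) := by
  rw [lineDerivOp_xiMul]
  exact add_eq_left.2 (zero_smul ℝ T)

lemma lineDerivOp_xiDir_xiMul (a b : Fin n) (T : 𝓓'(phaseSpace n, 𝕜)) :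
    ∂_{xiDir b} (xiMul a T) = xiMul a (∂_{xiDir b} T) + if a = b then T else 0 := by
  rw [lineDerivOp_xiMul]
  split_ifs with h
  · simp [stdVec, h]
  · have hab : stdVec b a = 0 := by simp [stdVec, h]
    exact congrArg (_ + ·) ((congrArg (· • T) hab).trans (zero_smul ℝ T))

/-- The Euler operator `∑ ξ^a ∂/∂ξ^a`. -/
def eulerField (T : 𝓓'(phaseSpace n, 𝕜)) : 𝓓'(phaseSpace n, 𝕜) :=
  ∑ a : Fin n, xiMul a (∂_{xiDir a} T)

lemma eulerField_sum {ι : Type*} (s : Finset ι) (T : ι → 𝓓'(phaseSpace n, 𝕜)) :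
    eulerField (∑ b ∈ s, T b) = ∑ b ∈ s, eulerField (T b) := by
  simp only [eulerField, LineDeriv.lineDerivOp_sum, map_sum]
  exact Finset.sum_comm

lemma eulerField_xiMul (a : Fin n) (T : 𝓓'(phaseSpace n, 𝕜)) :
    eulerField (xiMul a T) = xiMul a (eulerField T) + xiMul a T := by
  simp only [eulerField, lineDerivOp_xiDir_xiMul, map_add, Finset.sum_add_distrib, map_sum,
    xiMul_comm a]
  simp [apply_ite]

lemma eulerField_lineDerivOp_xiDir (b : Fin n) (T : 𝓓'(phaseSpace n, 𝕜)) :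
    eulerField (∂_{xiDir b} T) = ∂_{xiDir b} (eulerField T) - ∂_{xiDir b} T := by
  simp only [eulerField, LineDeriv.lineDerivOp_sum, lineDerivOp_xiDir_xiMul,
    Finset.sum_add_distrib]
  simp [lineDerivOp_comm (xiDir b)]

lemma eulerField_iteratedLineDerivOp_xiDir {d : ℝ} {T : 𝓓'(phaseSpace n, 𝕜)}
    (hT : eulerField T = d • T) {r : ℕ} (i : Fin r → Fin n) :
    eulerField (∂^{fun s => xiDir (i s)} T) = (d - r) • ∂^{fun s => xiDir (i s)} T := by
  induction r with
  | zero => simpa using hT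
  | succ r ih =>
    have h : ∂^{fun s => xiDir (i s)} T = ∂_{xiDir (i 0)} (∂^{fun s => xiDir (Fin.tail i s)} T) :=
      LineDeriv.iteratedLineDerivOp_succ_left _ _
    rw [h, eulerField_lineDerivOp_xiDir, ih, LineDeriv.lineDerivOp_smul]
    push_cast
    module

lemma smoothMul_monomial_xiMul {r : ℕ} (i : Fin r → Fin n) (a : Fin n)
    (T : 𝓓'(phaseSpace n, 𝕜)) :
    smoothMul (fun q => monomial i q.2) ((monomial_contDiff i).comp contDiff_snd) (xiMul a T) =
      smoothMul (fun q => monomial (Fin.cons a i : Fin (r + 1) → Fin n) q.2)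
        ((monomial_contDiff _).comp contDiff_snd) T := by
  ext ψ
  refine congrArg T (TestFunction.ext fun q => ?_)
  change ψ q * monomial i q.2 * q.2 a = ψ q * monomial (Fin.cons a i : Fin (r + 1) → Fin n) q.2
  simp only [monomial, Fin.prod_univ_succ, Fin.cons_zero, Fin.cons_succ]
  ring

lemma eulerOp_zero_left (T : 𝓓'(phaseSpace n, 𝕜)) : eulerOp 0 T = T := by
  ext ψ
  simp only [eulerOp, Finset.univ_unique, Finset.sum_singleton]
  refine congrArg T (TestFunction.ext fun q => ?_)
  change ψ q * monomial _ q.2 = ψ q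
  simp [monomial]

lemma eulerOp_succ (r : ℕ) (T : 𝓓'(phaseSpace n, 𝕜)) :
    eulerOp (r + 1) T = ∑ i : Fin r → Fin n, smoothMul (fun q => monomial i q.2)
      ((monomial_contDiff i).comp contDiff_snd) (eulerField (∂^{fun s => xiDir (i s)} T)) := by
  have map_sum_smoothMul (i : Fin r → Fin n) (S : Fin n → 𝓓'(phaseSpace n, 𝕜)) :
      smoothMul (fun q => monomial i q.2) ((monomial_contDiff i).comp contDiff_snd) (∑ a, S a) =
        ∑ a, smoothMul (fun q => monomial i q.2) ((monomial_contDiff i).comp contDiff_snd) (S a) :=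
    map_sum ((mulTest _ _).precompCompactConvergenceCLM 𝕜) S _
  simp only [eulerField, map_sum_smoothMul, smoothMul_monomial_xiMul]
  rw [eulerOp, ← (Fin.consEquiv fun _ => Fin n).sum_comp, Fintype.sum_prod_type_right]
  rfl

lemma eulerOp_eq_smul {d : ℝ} {T : 𝓓'(phaseSpace n, 𝕜)} (hT : eulerField T = d • T) (r : ℕ) :
    eulerOp r T = (∏ s ∈ Finset.range r, (d - s)) • T := by
  induction r with
  | zero => simp [eulerOp_zero_left]
  | succ r ih =>
    rw [Finset.prod_range_succ, mul_comm, mul_smul, ← ih, eulerOp_succ, eulerOp, Finset.smul_sum]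
    refine Finset.sum_congr rfl fun i _ => ?_
    rw [eulerField_iteratedLineDerivOp_xiDir hT]
    rfl

lemma eulerOp_sum {ι : Type*} (s : Finset ι) (r : ℕ) (T : ι → 𝓓'(phaseSpace n, 𝕜)) :
    eulerOp r (∑ a ∈ s, T a) = ∑ a ∈ s, eulerOp r (T a) := by
  have h (i : Fin r → Fin n) (S : ι → 𝓓'(phaseSpace n, 𝕜)) :=
    map_sum ((mulTest (fun q => monomial i q.2)
      ((monomial_contDiff i).comp contDiff_snd)).precompCompactConvergenceCLM 𝕜) S s
  simp only [eulerOp, LineDeriv.iteratedLineDerivOp_sum]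
  rw [Finset.sum_comm]
  exact Finset.sum_congr rfl fun i _ => h i _

lemma eulerOp_zero (r : ℕ) : eulerOp r (0 : 𝓓'(phaseSpace n, 𝕜)) = 0 := by
  simpa using eulerOp_sum ∅ r fun _ : Empty => (0 : 𝓓'(phaseSpace n, 𝕜))

lemma eulerOp_smul (r : ℕ) (c : ℝ) (T : 𝓓'(phaseSpace n, 𝕜)) :
    eulerOp r (c • T) = c • eulerOp r T := by
  simp only [eulerOp, LineDeriv.iteratedLineDerivOp_smul, Finset.smul_sum]
  rfl

end Euler

section IntegrationByParts

lemma integral_fderiv_apply_eq_zero {E : Type*} [NormedAddCommGroup E] [NormedSpace ℝ E]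
    [FiniteDimensional ℝ E] [MeasurableSpace E] [BorelSpace E] {μ : Measure E} [μ.IsAddHaarMeasure]
    {g : E → ℝ} (hg : ContDiff ℝ 1 g) (hc : HasCompactSupport g) (v : E) :
    ∫ q, fderiv ℝ g q v ∂μ = 0 := by
  have hd : Continuous fun q => fderiv ℝ g q v :=
    (hg.continuous_fderiv one_ne_zero).clm_apply continuous_const
  have h := integral_mul_fderiv_eq_neg_fderiv_mul_of_integrable (μ := μ)
    (f := fun _ : E => (1 : ℝ)) (g := g) (v := v) (by simp)
    (by simpa using hd.integrable_of_hasCompactSupport (hc.fderiv_apply (𝕜 := ℝ) v))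
    (by simpa using hg.continuous.integrable_of_hasCompactSupport hc)
    (fun _ _ => differentiableAt_const _) (fun x _ => hg.differentiable one_ne_zero x)
  simpa using h

variable {n : ℕ}

/-- The integrand `t^k ψ(x - tξ, ξ)` of the adjoint ray transform, as a function of `(ξ, t)`. -/
def rayKernel (k : ℕ) (ψ : 𝓓(phaseSpace n, ℝ)) (x : Rn n) (q : Rn n × ℝ) : ℝ :=
  q.2 ^ k * ψ (x - q.2 • q.1, q.1)

lemma contDiff_rayKernel (k : ℕ) (ψ : 𝓓(phaseSpace n, ℝ)) (x : Rn n) :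
    ContDiff ℝ ∞ (rayKernel k ψ x) := by
  have hψ : ContDiff ℝ ∞ (ψ : Rn n × Rn n → ℝ) := ψ.contDiff
  unfold rayKernel
  fun_prop

lemma hasCompactSupport_rayKernel (k : ℕ) (ψ : 𝓓(phaseSpace n, ℝ)) (x : Rn n) :
    HasCompactSupport (rayKernel k ψ x) := by
  obtain ⟨B, hB, hBx⟩ := exists_box ψ.hasCompactSupport ψ.tsupport_subset ‖x‖
  refine HasCompactSupport.intro hB fun q hq => ?_
  rw [rayKernel, image_eq_zero_of_notMem_tsupport fun h => hq (hBx x le_rfl _ _ h), mul_zero]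

lemma integrable_rayKernel (k : ℕ) (ψ : 𝓓(phaseSpace n, ℝ)) (x : Rn n) :
    Integrable (rayKernel k ψ x) :=
  (contDiff_rayKernel k ψ x).continuous.integrable_of_hasCompactSupport
    (hasCompactSupport_rayKernel k ψ x)

lemma adjoint_apply_eq_integral_rayKernel (k : ℕ) (i : Fin 0 → Fin n) (ψ : 𝓓(phaseSpace n, ℝ))
    (x : Rn n) : (adjoint k i ψ : Rn n → ℝ) x = ∫ q, rayKernel k ψ x q := by
  rw [adjoint_coe, backProj_eq ψ.hasCompactSupport ψ.tsupport_subset k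
    (monomial_contDiff i).continuous ψ.continuous fun _ => image_eq_zero_of_notMem_tsupport]
  simp [rayKernel, monomial]

lemma fderiv_rayKernel (k : ℕ) (ψ : 𝓓(phaseSpace n, ℝ)) (x : Rn n) (q v : Rn n × ℝ) :
    fderiv ℝ (rayKernel k ψ x) q v =
      k * q.2 ^ (k - 1) * v.2 * ψ (x - q.2 • q.1, q.1) +
        q.2 ^ k * fderiv ℝ ψ (x - q.2 • q.1, q.1) (-(q.2 • v.1 + v.2 • q.1), v.1) := by
  have hξ : HasFDerivAt (fun q : Rn n × ℝ => q.1) (.fst ℝ (Rn n) ℝ) q := hasFDerivAt_fst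
  have ht : HasFDerivAt (fun q : Rn n × ℝ => q.2) (.snd ℝ (Rn n) ℝ) q := hasFDerivAt_snd
  have hray : HasFDerivAt (fun q : Rn n × ℝ => (x - q.2 • q.1, q.1)) _ q :=
    ((ht.smul hξ).const_sub x).prodMk hξ
  have hψ : HasFDerivAt (fun q : Rn n × ℝ => ψ (x - q.2 • q.1, q.1)) _ q :=
    (ψ.contDiff.differentiable (by simp) (x - q.2 • q.1, q.1)).hasFDerivAt.comp q hray
  have hkernel : HasFDerivAt (rayKernel k ψ x) _ q := (ht.pow k).mul hψ
  rw [hkernel.fderiv]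
  simp only [neg_add_rev, nsmul_eq_mul, add_apply, smul_apply, ContinuousLinearMap.comp_apply,
    ContinuousLinearMap.prod_apply, neg_apply, ContinuousLinearMap.smulRight_apply,
    ContinuousLinearMap.coe_snd', ContinuousLinearMap.coe_fst', smul_eq_mul]
  ring

lemma integral_fderiv_rayKernel (k : ℕ) (ψ : 𝓓(phaseSpace n, ℝ)) (x : Rn n) (v : Rn n × ℝ) :
    ∫ q, fderiv ℝ (rayKernel k ψ x) q v = 0 := by
  have : (volume : Measure (Rn n × ℝ)).IsAddHaarMeasure :=
    inferInstanceAs ((volume : Measure (Rn n)).prod (volume : Measure ℝ)).IsAddHaarMeasure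
  exact integral_fderiv_apply_eq_zero ((contDiff_rayKernel k ψ x).of_le (by simp))
    (hasCompactSupport_rayKernel k ψ x) v

lemma adjoint_lineDerivOp_xiDir (a : Fin n) (k : ℕ) (i : Fin 0 → Fin n)
    (ψ : 𝓓(phaseSpace n, ℝ)) :
    adjoint k i (∂_{xiDir a} ψ) = adjoint (k + 1) i (∂_{xDir a} ψ) := by
  ext x
  rw [adjoint_apply_eq_integral_rayKernel, adjoint_apply_eq_integral_rayKernel, ← sub_eq_zero,
    ← integral_sub (integrable_rayKernel _ _ _) (integrable_rayKernel _ _ _),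
    ← integral_fderiv_rayKernel k ψ x (stdVec a, 0)]
  refine integral_congr_ae (.of_forall fun q => ?_)
  have hdir : ((-(q.2 • stdVec a + (0 : ℝ) • q.1), stdVec a) : Rn n × Rn n) =
      xiDir a - q.2 • xDir a := by simp
  simp only [rayKernel, fderiv_rayKernel, testFunction_lineDerivOp_apply, hdir, map_sub, map_smul,
    smul_eq_mul]
  ring

lemma sum_adjoint_lineDerivOp_xDir (i : Fin 0 → Fin n) (ψ : 𝓓(phaseSpace n, ℝ)) :
    ∑ a, adjoint 1 i (∂_{xDir a} (mulTest (fun q => q.2 a) (by fun_prop) ψ)) = adjoint 0 i ψ := by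
  ext x
  rw [Submodule.coe_sum, Finset.sum_apply]
  simp only [adjoint_apply_eq_integral_rayKernel]
  rw [← integral_finsetSum _ fun a _ => integrable_rayKernel _ _ _, eq_comm, ← sub_eq_zero,
    ← integral_sub (integrable_rayKernel _ _ _)
      (integrable_finsetSum _ fun a _ => integrable_rayKernel _ _ _),
    ← integral_fderiv_rayKernel 1 ψ x (0, 1)]
  refine integral_congr_ae (.of_forall fun q => ?_)
  have hdir : ((-(q.2 • (0 : Rn n) + (1 : ℝ) • q.1), 0) : Rn n × Rn n) =
      -∑ a, q.1 a • xDir a := by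
    refine Prod.ext ?_ ?_
    · ext b
      simp [stdVec, Prod.fst_sum, Finset.sum_apply, Pi.single_apply]
    · simp [Prod.snd_sum]
  have hmul (a : Fin n) (y : Rn n × Rn n) :
      fderiv ℝ (mulTest (fun q => q.2 a) (by fun_prop) ψ) y (xDir a) =
        y.2 a * fderiv ℝ ψ y (xDir a) := by
    have h := (ψ.contDiff.differentiable (by simp) y).hasFDerivAt.mul
      ((EuclideanSpace.proj a : Rn n →L[ℝ] ℝ).comp
        (ContinuousLinearMap.snd ℝ (Rn n) (Rn n))).hasFDerivAt
    refine (congrArg (· (xDir a)) h.fderiv).trans ?_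
    simp
  simp only [rayKernel, fderiv_rayKernel, hdir, testFunction_lineDerivOp_apply, hmul, map_neg,
    map_sum, map_smul, smul_eq_mul, ← Finset.mul_sum]
  simp only [pow_zero, one_mul, pow_one, Nat.cast_one, tsub_self, mul_one, mul_neg]
  ring

end IntegrationByParts

section RayTransform

variable {𝕜 : Type*} [RCLike 𝕜] {n p : ℕ}

/-- The tensor field `f_{a i₁ … i_p}` of rank `p` obtained by fixing the first index of `f`. -/
def slice (a : Fin n) (f : symTensors 𝕜 n (p + 1)) : symTensors 𝕜 n p :=
  ⟨fun i => f.1 (Fin.cons a i), fun π i => by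
    refine Eq.trans (congrArg f.1 (funext fun s => ?_))
      (f.2 (Equiv.Perm.decomposeFin.symm (0, π)) (Fin.cons a i))
    induction s using Fin.cases <;> simp⟩

lemma slice_slice_comm (a b : Fin n) (f : symTensors 𝕜 n (p + 2)) :
    slice a (slice b f) = slice b (slice a f) := by
  refine Subtype.ext (funext fun i => ?_)
  refine Eq.trans ?_ (f.2 (Equiv.swap 0 1) (Fin.cons a (Fin.cons b i)))
  refine congrArg f.1 (funext fun s => ?_)
  induction s using Fin.cases with
  | zero => simp
  | succ s =>
    induction s using Fin.cases with
    | zero => simp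
    | succ s =>
      have h : (Equiv.swap 0 1 : Equiv.Perm (Fin (p + 2))) s.succ.succ = s.succ.succ :=
        Equiv.swap_apply_of_ne_of_ne (Fin.succ_ne_zero _) (by simp [Fin.ext_iff])
      simp [h]

lemma componentTransform_cons (k : ℕ) (a : Fin n) (i : Fin p → Fin n)
    (u : compactDistributions 𝕜 n) :
    componentTransform k (Fin.cons a i : Fin (p + 1) → Fin n) u =
      xiMul a (componentTransform k i u) := by
  ext ψ
  refine congrArg u.1 (Subtype.ext (funext fun x => ?_))
  refine integral_congr_ae (.of_forall fun ξ => integral_congr_ae (.of_forall fun t => ?_))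
  change t ^ k * monomial (Fin.cons a i : Fin (p + 1) → Fin n) ξ * ψ (x - t • ξ, ξ) =
    t ^ k * monomial i ξ * (ψ (x - t • ξ, ξ) * ξ a)
  simp only [monomial, Fin.prod_univ_succ, Fin.cons_zero, Fin.cons_succ]
  ring

lemma momentRay_succ (k : ℕ) (f : symTensors 𝕜 n (p + 1)) :
    momentRay k f = ∑ a, xiMul a (momentRay k (slice a f)) := by
  simp only [momentRay, map_sum, ← componentTransform_cons]
  rw [← (Fin.consEquiv fun _ => Fin n).sum_comp, Fintype.sum_prod_type]
  rfl

lemma momentRay_rank_zero_apply (k : ℕ) (f : symTensors 𝕜 n 0) (ψ : 𝓓(phaseSpace n, ℝ)) :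
    momentRay k f ψ = (f.1 ![]).1 (adjoint k ![] ψ) := by
  rw [momentRay, Fintype.sum_unique]
  exact congrArg (fun i => (f.1 i).1 (adjoint k i ψ)) (Subsingleton.elim _ _)

/-- The operator `(T_k) ↦ (∂T_k/∂ξ^a - ∂T_{k+1}/∂x^a)` on sequences of distributions. It vanishes
on the momentum transforms of functions, so on a sequence `w(ξ) I^k u` it differentiates the weight
`w`. -/
def weightDeriv (a : Fin n) (T : ℕ → 𝓓'(phaseSpace n, 𝕜)) (k : ℕ) : 𝓓'(phaseSpace n, 𝕜) :=
  ∂_{xiDir a} (T k) - ∂_{xDir a} (T (k + 1))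

lemma weightDeriv_momentRay_rank_zero (a : Fin n) (f : symTensors 𝕜 n 0) (k : ℕ) :
    weightDeriv a (momentRay · f) k = 0 := by
  refine sub_eq_zero.2 ?_
  ext ψ
  rw [Distribution.lineDerivOp_apply_apply, Distribution.lineDerivOp_apply_apply, map_neg, map_neg,
    momentRay_rank_zero_apply, momentRay_rank_zero_apply, adjoint_lineDerivOp_xiDir]

lemma weightDeriv_sum_xiMul (b : Fin n) (T : Fin n → ℕ → 𝓓'(phaseSpace n, 𝕜)) (k : ℕ) :
    weightDeriv b (fun k => ∑ a, xiMul a (T a k)) k =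
      ∑ a, xiMul a (weightDeriv b (T a) k) + T b k := by
  simp only [weightDeriv, LineDeriv.lineDerivOp_sum, lineDerivOp_xDir_xiMul,
    lineDerivOp_xiDir_xiMul, Finset.sum_add_distrib, map_sub, Finset.sum_sub_distrib]
  simp only [Finset.sum_ite_eq', Finset.mem_univ, ↓reduceIte]
  abel

lemma weightDeriv_momentRay_succ (b : Fin n) (f : symTensors 𝕜 n (p + 1)) (k : ℕ) :
    weightDeriv b (momentRay · f) k = ((p : ℝ) + 1) • momentRay k (slice b f) := by
  have leibniz {p : ℕ} (f : symTensors 𝕜 n (p + 1)) : weightDeriv b (momentRay · f) k =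
      ∑ a, xiMul a (weightDeriv b (momentRay · (slice a f)) k) + momentRay k (slice b f) := by
    rw [← weightDeriv_sum_xiMul]
    exact congrArg (weightDeriv b · k) (funext fun k => momentRay_succ k f)
  induction p with
  | zero => simp [leibniz, weightDeriv_momentRay_rank_zero]
  | succ p ih =>
    simp only [leibniz f, ih, slice_slice_comm b, map_smul, ← Finset.smul_sum, ← momentRay_succ]
    push_cast
    module

lemma eulerField_momentRay_rank_zero (f : symTensors 𝕜 n 0) :
    eulerField (momentRay 0 f) = -momentRay 0 f := by
  have hx (a : Fin n) : ∂_{xiDir a} (momentRay 0 f) = ∂_{xDir a} (momentRay 1 f) :=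
    sub_eq_zero.1 (weightDeriv_momentRay_rank_zero a f 0)
  ext ψ
  simp only [eulerField, hx]
  change (∑ a, xiMul a (∂_{xDir a} (momentRay 1 f))) ψ = -momentRay 0 f ψ
  rw [sum_apply, momentRay_rank_zero_apply, ← sum_adjoint_lineDerivOp_xDir, map_sum,
    ← Finset.sum_neg_distrib]
  refine Finset.sum_congr rfl fun a _ => ?_
  rw [← momentRay_rank_zero_apply]
  rfl

/-- The degree is `p - 1` and not `p` because parametrizing a line by `tξ` rescales `dt`. -/
lemma eulerField_momentRay (f : symTensors 𝕜 n p) :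
    eulerField (momentRay 0 f) = ((p : ℝ) - 1) • momentRay 0 f := by
  induction p with
  | zero =>
    rw [eulerField_momentRay_rank_zero, Nat.cast_zero, zero_sub]
    exact (neg_one_smul ℝ _).symm
  | succ p ih =>
    simp only [momentRay_succ, eulerField_sum, eulerField_xiMul, ih, map_smul, Finset.smul_sum]
    push_cast
    refine Finset.sum_congr rfl fun a _ => ?_
    module

end RayTransform

section AlternatingDerivative

variable {M : Type*} [AddCommMonoid M] {α : Type*} {j : ℕ}

lemma sum_perm_init (i : Fin (j + 1) → α) (G : α → (Fin j → α) → M) :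
    ∑ π : Equiv.Perm (Fin (j + 1)), G (i (π (Fin.last j))) (Fin.init (i ∘ π)) =
      ∑ π : Equiv.Perm (Fin (j + 1)), G (i (π 0)) (Fin.tail (i ∘ π)) := by
  rw [← Equiv.sum_comp (Equiv.mulRight (finRotate (j + 1)))]
  refine Finset.sum_congr rfl fun π _ => ?_
  have hinit : Fin.init (i ∘ (Equiv.mulRight (finRotate (j + 1)) π)) = Fin.tail (i ∘ π) :=
    funext fun s => congrArg (fun t => i (π t)) (finRotate_of_lt s.2)
  rw [hinit, Equiv.coe_mulRight, Equiv.Perm.mul_apply, finRotate_last]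

lemma sum_perm_tail (i : Fin (j + 1) → α) (G : α → (Fin j → α) → M) :
    ∑ π : Equiv.Perm (Fin (j + 1)), G (i (π 0)) (Fin.tail (i ∘ π)) =
      ∑ a, ∑ π : Equiv.Perm (Fin j), G (i a) (Fin.tail (i ∘ Equiv.swap 0 a) ∘ π) := by
  rw [← Equiv.Perm.decomposeFin.symm.sum_comp, Fintype.sum_prod_type]
  refine Finset.sum_congr rfl fun a _ => Finset.sum_congr rfl fun π _ => ?_
  rw [Equiv.Perm.decomposeFin_symm_apply_zero]
  exact congrArg (G (i a)) (funext fun s => by simp [Fin.tail])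

variable {𝕜 : Type*} [RCLike 𝕜] {n : ℕ}

/-- The combination `∑_k (-1)^k (j choose k) ∂^j T_k / ∂x^{i₁}⋯∂x^{i_k} ∂ξ^{i_{k+1}}⋯∂ξ^{i_j}` of
derivatives of a sequence of distributions, as it occurs in the reconstruction formula. -/
def altDeriv (i : Fin j → Fin n) (T : ℕ → 𝓓'(phaseSpace n, 𝕜)) : 𝓓'(phaseSpace n, 𝕜) :=
  ∑ k ∈ Finset.range (j + 1), ((-1 : ℝ) ^ k * (j.choose k : ℝ)) • mixedDeriv k i (T k)

lemma altDeriv_eq_zero {T : ℕ → 𝓓'(phaseSpace n, 𝕜)} (hT : ∀ k ≤ j, T k = 0) (i : Fin j → Fin n) :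
    altDeriv i T = 0 := by
  refine Finset.sum_eq_zero fun k hk => ?_
  rw [hT k (Finset.mem_range_succ_iff.1 hk), mixedDeriv, LineDeriv.iteratedLineDerivOp_zero]
  exact smul_zero (M := ℝ) (A := 𝓓'(phaseSpace n, 𝕜)) _

lemma altDeriv_sum {ι : Type*} (s : Finset ι) (i : Fin j → Fin n)
    (T : ι → ℕ → 𝓓'(phaseSpace n, 𝕜)) :
    altDeriv i (fun k => ∑ a ∈ s, T a k) = ∑ a ∈ s, altDeriv i (T a) := by
  simp only [altDeriv, mixedDeriv, LineDeriv.iteratedLineDerivOp_sum, Finset.smul_sum]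
  exact Finset.sum_comm

lemma altDeriv_sub (i : Fin j → Fin n) (T S : ℕ → 𝓓'(phaseSpace n, 𝕜)) :
    altDeriv i (fun k => T k - S k) = altDeriv i T - altDeriv i S := by
  simp only [altDeriv, mixedDeriv, sub_eq_add_neg, LineDeriv.iteratedLineDerivOp_add,
    LineDeriv.iteratedLineDerivOp_neg, smul_add, smul_neg, Finset.sum_add_distrib,
    Finset.sum_neg_distrib]

lemma altDeriv_smul (i : Fin j → Fin n) (c : ℝ) (T : ℕ → 𝓓'(phaseSpace n, 𝕜)) :
    altDeriv i (fun k => c • T k) = c • altDeriv i T := by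
  simp only [altDeriv, mixedDeriv, LineDeriv.iteratedLineDerivOp_smul, Finset.smul_sum]
  exact Finset.sum_congr rfl fun k _ => smul_comm _ _ _

lemma mixedDeriv_of_le {k : ℕ} (hk : k ≤ j) (i : Fin (j + 1) → Fin n) (T : 𝓓'(phaseSpace n, 𝕜)) :
    mixedDeriv k i T = mixedDeriv k (Fin.init i) (∂_{xiDir (i (Fin.last j))} T) := by
  rw [mixedDeriv, LineDeriv.iteratedLineDerivOp_succ_right, mixedDeriv]
  simp only [Fin.init_def, Fin.val_castSucc, Fin.val_last, not_lt.2 hk, if_false]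

lemma mixedDeriv_succ (k : ℕ) (i : Fin (j + 1) → Fin n) (T : 𝓓'(phaseSpace n, 𝕜)) :
    mixedDeriv (k + 1) i T = mixedDeriv k (Fin.tail i) (∂_{xDir (i 0)} T) := by
  rw [mixedDeriv, LineDeriv.iteratedLineDerivOp_succ_left, lineDerivOp_iteratedLineDerivOp_comm,
    mixedDeriv]
  simp only [Fin.tail_def, Fin.val_succ, Nat.add_lt_add_iff_right, Fin.val_zero, Nat.succ_pos,
    if_true]

lemma altDeriv_succ (i : Fin (j + 1) → Fin n) (T : ℕ → 𝓓'(phaseSpace n, 𝕜)) :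
    altDeriv i T = altDeriv (Fin.init i) (fun k => ∂_{xiDir (i (Fin.last j))} (T k)) -
      altDeriv (Fin.tail i) (fun k => ∂_{xDir (i 0)} (T (k + 1))) := by
  have hinit : altDeriv (Fin.init i) (fun k => ∂_{xiDir (i (Fin.last j))} (T k)) =
      ∑ k ∈ Finset.range (j + 2), ((-1 : ℝ) ^ k * (j.choose k : ℝ)) • mixedDeriv k i (T k) := by
    have hlast : ((-1 : ℝ) ^ (j + 1) * (j.choose (j + 1) : ℝ)) • mixedDeriv (j + 1) i (T (j + 1)) =
        0 := by
      rw [Nat.choose_succ_self, Nat.cast_zero, mul_zero]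
      exact zero_smul ℝ (mixedDeriv (j + 1) i (T (j + 1)))
    rw [Finset.sum_range_succ, hlast, add_zero, altDeriv]
    exact Finset.sum_congr rfl fun k hk => by rw [mixedDeriv_of_le (Finset.mem_range_succ_iff.1 hk)]
  rw [hinit]
  simp only [altDeriv, ← mixedDeriv_succ]
  rw [Finset.sum_range_succ' _ (j + 1), Finset.sum_range_succ' _ (j + 1), add_sub_right_comm,
    ← Finset.sum_sub_distrib]
  refine congrArg₂ _ (Finset.sum_congr rfl fun k _ => ?_) (by simp)
  rw [Nat.choose_succ_succ, pow_succ]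
  push_cast
  module

/-- The sum of `altDeriv` over all permutations of the indices, i.e. `j!` times its
symmetrization. -/
def symAltDeriv (i : Fin j → Fin n) (T : ℕ → 𝓓'(phaseSpace n, 𝕜)) : 𝓓'(phaseSpace n, 𝕜) :=
  ∑ π : Equiv.Perm (Fin j), altDeriv (i ∘ π) T

lemma symAltDeriv_sum {ι : Type*} (s : Finset ι) (i : Fin j → Fin n)
    (T : ι → ℕ → 𝓓'(phaseSpace n, 𝕜)) :
    symAltDeriv i (fun k => ∑ a ∈ s, T a k) = ∑ a ∈ s, symAltDeriv i (T a) := by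
  simp only [symAltDeriv, altDeriv_sum]
  exact Finset.sum_comm

lemma symAltDeriv_smul (i : Fin j → Fin n) (c : ℝ) (T : ℕ → 𝓓'(phaseSpace n, 𝕜)) :
    symAltDeriv i (fun k => c • T k) = c • symAltDeriv i T := by
  simp only [symAltDeriv, altDeriv_smul, Finset.smul_sum]

lemma symAltDeriv_zero (i : Fin j → Fin n) :
    symAltDeriv i (fun _ => (0 : 𝓓'(phaseSpace n, 𝕜))) = 0 := by
  simpa using symAltDeriv_sum ∅ i fun (_ : Empty) _ => (0 : 𝓓'(phaseSpace n, 𝕜))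

lemma symAltDeriv_rank_zero (i : Fin 0 → Fin n) (T : ℕ → 𝓓'(phaseSpace n, 𝕜)) :
    symAltDeriv i T = T 0 := by
  simp [symAltDeriv, altDeriv, mixedDeriv]

/-- After symmetrization the two derivatives in Pascal's recursion `altDeriv_succ` may be taken in
the same direction, where they combine to `weightDeriv`. -/
lemma symAltDeriv_succ (i : Fin (j + 1) → Fin n) (T : ℕ → 𝓓'(phaseSpace n, 𝕜)) :
    symAltDeriv i T =
      ∑ a, symAltDeriv (Fin.tail (i ∘ Equiv.swap 0 a)) (weightDeriv (i a) T) := by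
  simp only [symAltDeriv, altDeriv_succ, Finset.sum_sub_distrib, Function.comp_apply]
  rw [sum_perm_init i fun a i' => altDeriv i' fun k => ∂_{xiDir a} (T k),
    ← Finset.sum_sub_distrib, sum_perm_tail i fun a i' =>
      altDeriv i' (fun k => ∂_{xiDir a} (T k)) - altDeriv i' fun k => ∂_{xDir a} (T (k + 1))]
  simp only [← altDeriv_sub]
  rfl

end AlternatingDerivative

section Reconstruction

variable {𝕜 : Type*} [RCLike 𝕜] {n p j : ℕ}

lemma symAltDeriv_momentRay_rank_zero (i : Fin (j + 1) → Fin n) (f : symTensors 𝕜 n 0) :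
    symAltDeriv i (momentRay · f) = 0 := by
  have hzero (a : Fin n) : weightDeriv a (momentRay · f) = fun _ => 0 :=
    funext (weightDeriv_momentRay_rank_zero a f)
  rw [symAltDeriv_succ]
  exact Finset.sum_eq_zero fun a _ => by rw [hzero, symAltDeriv_zero]

lemma symAltDeriv_momentRay_succ (i : Fin (j + 1) → Fin n) (f : symTensors 𝕜 n (p + 1)) :
    symAltDeriv i (momentRay · f) = ((p : ℝ) + 1) •
      ∑ a, symAltDeriv (Fin.tail (i ∘ Equiv.swap 0 a)) (momentRay · (slice (i a) f)) := by
  have hslice (a : Fin n) : weightDeriv a (momentRay · f) =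
      fun k => ((p : ℝ) + 1) • momentRay k (slice a f) :=
    funext (weightDeriv_momentRay_succ a f)
  rw [symAltDeriv_succ, Finset.smul_sum]
  simp only [hslice, symAltDeriv_smul]

lemma slice_tail_swap (f : symTensors 𝕜 n (p + 1)) (i : Fin (p + 1) → Fin n) (a : Fin (p + 1)) :
    (slice (i a) f).1 (Fin.tail (i ∘ Equiv.swap 0 a)) = f.1 i := by
  have hcons : Fin.cons (i a) (Fin.tail (i ∘ Equiv.swap 0 a)) = i ∘ Equiv.swap 0 a := by
    simpa using Fin.cons_self_tail (i ∘ Equiv.swap 0 a)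
  exact (congrArg f.1 hcons).trans (f.2 _ i)

lemma symAltDeriv_momentRay (f : symTensors 𝕜 n j) (i : Fin j → Fin n) :
    symAltDeriv i (momentRay · f) =
      (j.factorial : ℝ) ^ 2 • momentRay 0 (scalarTensor (f.1 i)) := by
  induction j with
  | zero =>
    have hf : f = scalarTensor (f.1 i) :=
      Subtype.ext (funext fun i' => congrArg f.1 (Subsingleton.elim i' i))
    simp [symAltDeriv_rank_zero, ← hf]
  | succ j ih =>
    simp only [symAltDeriv_momentRay_succ, ih, slice_tail_swap, Finset.sum_const, Finset.card_univ,
      Fintype.card_fin, Nat.factorial_succ]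
    rw [← Nat.cast_smul_eq_nsmul ℝ]
    push_cast
    module

lemma eulerOp_momentRay_of_pos {r : ℕ} (hp : 0 < p) (hr : p ≤ r) (f : symTensors 𝕜 n p) :
    eulerOp r (momentRay 0 f) = 0 := by
  rw [eulerOp_eq_smul (eulerField_momentRay f), Finset.prod_eq_zero (i := p - 1)
    (Finset.mem_range.2 (by omega)) (by rw [Nat.cast_pred hp, sub_self])]
  exact zero_smul ℝ (momentRay 0 f)

lemma eulerOp_momentRay_rank_zero (r : ℕ) (f : symTensors 𝕜 n 0) :
    eulerOp r (momentRay 0 f) = ((-1 : ℝ) ^ r * r.factorial) • momentRay 0 f := by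
  have hprod : ∏ s ∈ Finset.range r, (((0 : ℕ) : ℝ) - 1 - s) = (-1) ^ r * r.factorial := by
    have hneg (s : ℕ) : ((0 : ℕ) : ℝ) - 1 - s = -((s + 1 : ℕ) : ℝ) := by push_cast; ring
    simp only [hneg]
    rw [Finset.prod_neg, Finset.card_range, ← Finset.prod_range_add_one_eq_factorial, Nat.cast_prod]
  rw [eulerOp_eq_smul (eulerField_momentRay f), hprod]

lemma eulerOp_symAltDeriv_momentRay_of_ne {r : ℕ} (hpj : p ≠ j) (hpr : p ≤ r + j)
    (f : symTensors 𝕜 n p) (i : Fin j → Fin n) :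
    eulerOp r (symAltDeriv i (momentRay · f)) = 0 := by
  induction j generalizing p with
  | zero =>
    rw [symAltDeriv_rank_zero]
    exact eulerOp_momentRay_of_pos (Nat.pos_of_ne_zero hpj) hpr f
  | succ j ih =>
    cases p with
    | zero => rw [symAltDeriv_momentRay_rank_zero, eulerOp_zero]
    | succ p =>
      have hterm (a : Fin (j + 1)) :=
        ih (by omega) (by omega) (slice (i a) f) (Fin.tail (i ∘ Equiv.swap 0 a))
      rw [symAltDeriv_momentRay_succ, eulerOp_smul, eulerOp_sum]
      simp only [hterm, Finset.sum_const_zero]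
      exact smul_zero _

theorem momentRay_component_eq {m : ℕ} (F : TensorSums 𝕜 n m) (j : ℕ) (hj : j ≤ m)
    (i : Fin j → Fin n) :
    momentRay 0 (scalarTensor ((F ⟨j, Nat.lt_succ_of_le hj⟩).1 i)) =
      ((-1 : ℝ) ^ (m - j) / ((m - j).factorial * j.factorial)) •
        symmetrize (fun i' : Fin j → Fin n =>
          eulerOp (m - j) (altDeriv i' (genMomentRay · F))) i := by
  have hsym : symmetrize
      (fun i' : Fin j → Fin n => eulerOp (m - j) (altDeriv i' (genMomentRay · F))) i =
      (j.factorial : ℝ)⁻¹ •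
        ∑ p : Fin (m + 1), eulerOp (m - j) (symAltDeriv i (momentRay · (F p))) := by
    rw [symmetrize, ← eulerOp_sum, ← eulerOp_sum, ← symAltDeriv_sum]
    rfl
  have hcoeff : (-1 : ℝ) ^ (m - j) / ((m - j).factorial * j.factorial) * (j.factorial : ℝ)⁻¹ *
      (j.factorial : ℝ) ^ 2 * ((-1) ^ (m - j) * (m - j).factorial) = 1 := by
    have hsq : ((-1 : ℝ) ^ (m - j)) ^ 2 = 1 := by rw [← pow_mul, mul_comm, pow_mul]; simp
    field_simp
    exact hsq
  rw [hsym, Finset.sum_eq_single ⟨j, Nat.lt_succ_of_le hj⟩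
    (fun p _ hp => eulerOp_symAltDeriv_momentRay_of_ne (fun h => hp (Fin.ext h))
      (by rw [Nat.sub_add_cancel hj]; exact Nat.le_of_lt_succ p.2) (F p) i) (by simp),
    symAltDeriv_momentRay, eulerOp_smul, eulerOp_momentRay_rank_zero, smul_smul, smul_smul,
    smul_smul, hcoeff, one_smul]

end Reconstruction

section CompactDistributions

lemma exists_continuousLinearMap_comp_eq {V W G : Type*} [AddCommGroup V] [Module ℝ V]
    [NormedAddCommGroup W] [NormedSpace ℝ W] [NormedAddCommGroup G] [NormedSpace ℝ G]
    [FiniteDimensional ℝ G] (j : V →ₗ[ℝ] W) (u : V →ₗ[ℝ] G) {C : ℝ}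
    (hu : ∀ v, ‖u v‖ ≤ C * ‖j v‖) : ∃ U : W →L[ℝ] G, ∀ v, u v = U (j v) := by
  obtain ⟨s, hs⟩ := j.rangeRestrict.exists_rightInverse_of_surjective j.range_rangeRestrict
  have hjs (w : LinearMap.range j) : j (s w) = w := congrArg Subtype.val (LinearMap.congr_fun hs w)
  let f : LinearMap.range j →L[ℝ] G := (u ∘ₗ s).mkContinuous C fun w => by
    simpa [hjs] using hu (s w)
  have : FiniteDimensional ℝ f.toLinearMap.range := FiniteDimensional.finiteDimensional_submodule _
  obtain ⟨U, hU⟩ := f.exist_extension_of_finiteDimensional_range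
  refine ⟨U, fun v => ?_⟩
  have hv : u v = u (s (j.rangeRestrict v)) := by
    rw [← sub_eq_zero, ← map_sub, ← norm_le_zero_iff]
    refine (hu _).trans_eq ?_
    rw [map_sub, hjs]
    simp
  exact hv.trans (congrArg (fun g : LinearMap.range j →L[ℝ] G => g (j.rangeRestrict v)) hU)

variable {𝕜 : Type*} [RCLike 𝕜] {n : ℕ}

/-- The normed space of `l`-linear forms on `ℝⁿ`. Sealing it in a definition lets instance search
find the norm of `JetSpace` below. -/
def MultilinearForms (n l : ℕ) : Type := Rn n [×l]→L[ℝ] ℝ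

instance (n l : ℕ) : NormedAddCommGroup (MultilinearForms n l) :=
  inferInstanceAs (NormedAddCommGroup (Rn n [×l]→L[ℝ] ℝ))

instance (n l : ℕ) : NormedSpace ℝ (MultilinearForms n l) :=
  inferInstanceAs (NormedSpace ℝ (Rn n [×l]→L[ℝ] ℝ))

instance (n l : ℕ) : CompleteSpace (MultilinearForms n l) :=
  inferInstanceAs (CompleteSpace (Rn n [×l]→L[ℝ] ℝ))

/-- The `l`-th derivative of a function as a map to the normed space of `l`-linear forms. -/
def formDeriv (l : ℕ) (φ : Rn n → ℝ) (x : Rn n) : MultilinearForms n l := iteratedFDeriv ℝ l φ x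

/-- The Banach space of families of continuous functions on `K` in which the derivatives of order
at most `N` of smooth functions lie. -/
abbrev JetSpace (n N : ℕ) (K : Set (Rn n)) : Type :=
  (l : Fin (N + 1)) → C(K, MultilinearForms n l)

lemma smoothFunctions_contDiff (φ : smoothFunctions n) : ContDiff ℝ ∞ (φ : Rn n → ℝ) := φ.2

lemma continuous_formDeriv (l : ℕ) (φ : smoothFunctions n) :
    Continuous (formDeriv l (φ : Rn n → ℝ)) :=
  (smoothFunctions_contDiff φ).continuous_iteratedFDeriv (m := l) (by exact_mod_cast le_top)

/-- The derivatives of order at most `N` on `K` of a smooth function. -/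
def jet (N : ℕ) (K : Set (Rn n)) : smoothFunctions n →ₗ[ℝ] JetSpace n N K where
  toFun φ l := ⟨fun x => formDeriv l (φ : Rn n → ℝ) x,
    (continuous_formDeriv l φ).comp continuous_subtype_val⟩
  map_add' φ ψ := by
    funext l
    ext1 x
    exact iteratedFDeriv_add_apply
      ((smoothFunctions_contDiff φ).of_le (by exact_mod_cast le_top)).contDiffAt
      ((smoothFunctions_contDiff ψ).of_le (by exact_mod_cast le_top)).contDiffAt
  map_smul' c φ := by
    funext l
    ext1 x
    exact iteratedFDeriv_const_smul_apply
      ((smoothFunctions_contDiff φ).of_le (by exact_mod_cast le_top)).contDiffAt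

lemma exists_jet_functional (u : compactDistributions 𝕜 n) :
    ∃ K : Set (Rn n), ∃ _ : CompactSpace K, ∃ (N : ℕ) (U : JetSpace n N K →L[ℝ] 𝕜),
      ∀ φ, u.1 φ = U (jet N K φ) := by
  obtain ⟨K, hK, N, C, hC⟩ := u.2
  have : CompactSpace K := isCompact_iff_compactSpace.1 hK
  obtain ⟨U, hU⟩ := exists_continuousLinearMap_comp_eq (jet N K) u.1 fun φ =>
    hC φ _ (norm_nonneg _) fun l hl x hx =>
      ((jet N K φ ⟨l, Nat.lt_succ_of_le hl⟩).norm_coe_le_norm ⟨x, hx⟩).trans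
        (norm_le_pi_norm (jet N K φ) ⟨l, Nat.lt_succ_of_le hl⟩)
  exact ⟨K, this, N, U, hU⟩

section Parameter

variable {V : Type*} [TopologicalSpace V] {Φ : V → smoothFunctions n}

lemma continuous_jet (hΦ : ∀ l : ℕ, Continuous fun q : V × Rn n =>
    formDeriv l (Φ q.1 : Rn n → ℝ) q.2) (N : ℕ) (K : Set (Rn n)) :
    Continuous fun v => jet N K (Φ v) :=
  continuous_pi fun l => ContinuousMap.continuous_of_continuous_uncurry _
    ((hΦ l).comp (continuous_fst.prodMk (continuous_subtype_val.comp continuous_snd)))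

lemma continuous_apply_of_continuous_formDeriv (u : compactDistributions 𝕜 n)
    (hΦ : ∀ l : ℕ, Continuous fun q : V × Rn n => formDeriv l (Φ q.1 : Rn n → ℝ) q.2) :
    Continuous fun v => u.1 (Φ v) := by
  obtain ⟨K, _, N, U, hU⟩ := exists_jet_functional u
  simp only [hU]
  exact U.continuous.comp (continuous_jet hΦ N K)

variable [MeasurableSpace V] [OpensMeasurableSpace V] [SecondCountableTopology V] {μ : Measure V}

lemma integrable_jet
    (hΦ : ∀ l : ℕ, Continuous fun q : V × Rn n => formDeriv l (Φ q.1 : Rn n → ℝ) q.2)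
    {g : ℕ → V → ℝ} (hg : ∀ l, Integrable (g l) μ)
    (hΦg : ∀ l v x, ‖formDeriv l (Φ v : Rn n → ℝ) x‖ ≤ g l v)
    (N : ℕ) (K : Set (Rn n)) [CompactSpace K] : Integrable (fun v => jet N K (Φ v)) μ := by
  have hg0 (l : ℕ) (v : V) : 0 ≤ g l v := (norm_nonneg _).trans (hΦg l v 0)
  refine (integrable_finsetSum Finset.univ fun (l : Fin (N + 1)) _ => hg l).mono'
    (continuous_jet hΦ N K).aestronglyMeasurable (.of_forall fun v => ?_)
  refine (pi_norm_le_iff_of_nonneg (x := jet N K (Φ v))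
    (Finset.sum_nonneg fun (l : Fin (N + 1)) _ => hg0 l v)).2 fun l => ?_
  refine le_trans ((ContinuousMap.norm_le _ (hg0 l v)).2 fun x => hΦg l v x) ?_
  exact Finset.single_le_sum (f := fun l : Fin (N + 1) => g l v) (fun l _ => hg0 l v)
    (Finset.mem_univ l)

lemma apply_eq_integral_apply (u : compactDistributions 𝕜 n) (Ψ : smoothFunctions n)
    (hΦ : ∀ l : ℕ, Continuous fun q : V × Rn n => formDeriv l (Φ q.1 : Rn n → ℝ) q.2)
    {g : ℕ → V → ℝ} (hg : ∀ l, Integrable (g l) μ)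
    (hΦg : ∀ l v x, ‖formDeriv l (Φ v : Rn n → ℝ) x‖ ≤ g l v)
    (hΨ : ∀ (l : ℕ) x, formDeriv l (Ψ : Rn n → ℝ) x =
      ∫ v, formDeriv l (Φ v : Rn n → ℝ) x ∂μ) :
    u.1 Ψ = ∫ v, u.1 (Φ v) ∂μ := by
  obtain ⟨K, _, N, U, hU⟩ := exists_jet_functional u
  have hint := integrable_jet hΦ hg hΦg N K
  have hjet : jet N K Ψ = ∫ v, jet N K (Φ v) ∂μ := by
    funext l
    ext1 x
    exact (hΨ l x).trans (((ContinuousMap.evalCLM ℝ x).comp (ContinuousLinearMap.proj (R := ℝ)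
      (φ := fun l : Fin (N + 1) => C(K, MultilinearForms n l)) l)).integral_comp_comm hint)
  simp only [hU]
  rw [hjet, U.integral_comp_comm hint]

end Parameter

lemma exists_apply_eq_of_eqOn_ball (u : compactDistributions 𝕜 n) :
    ∃ R : ℝ, 0 < R ∧ ∀ φ ψ : smoothFunctions n,
      Set.EqOn (φ : Rn n → ℝ) ψ (Metric.ball 0 R) → u.1 φ = u.1 ψ := by
  obtain ⟨K, hK, N, C, hC⟩ := u.2
  obtain ⟨R, hR, hKR⟩ := hK.isBounded.subset_ball_lt 0 0
  refine ⟨R, hR, fun φ ψ h => ?_⟩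
  rw [← sub_eq_zero, ← map_sub, ← norm_le_zero_iff, ← mul_zero C]
  refine hC _ _ le_rfl fun l _ x hx => ?_
  have hzero : ((φ - ψ : smoothFunctions n) : Rn n → ℝ) =ᶠ[nhds x] fun _ => 0 := by
    filter_upwards [Metric.isOpen_ball.mem_nhds (hKR hx)] with y hy
    exact sub_eq_zero.2 (h hy)
  rw [(hzero.iteratedFDeriv ℝ l).self_of_nhds]
  simp

end CompactDistributions

section PlaneWaves

open VectorFourier Real
open scoped FourierTransform

variable {𝕜 : Type*} [RCLike 𝕜] {n : ℕ} {V : Type*} [NormedAddCommGroup V] [MeasurableSpace V]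
  [BorelSpace V]

lemma integrable_dirac_moment (f : V → ℂ) (v : V) (l : ℕ) :
    Integrable (fun y => ‖y‖ ^ l * ‖f y‖) (Measure.dirac v) :=
  integrable_dirac (by simp [← enorm_norm])

variable [NormedSpace ℝ V] [SecondCountableTopology V]

-- A plane wave is the Fourier integral of a point mass, so the differentiation formulas for
-- Fourier integrals apply to it.
lemma fourierIntegral_dirac (L : V →L[ℝ] Rn n →L[ℝ] ℝ) (f : V → ℂ) (v : V) :
    fourierIntegral 𝐞 (Measure.dirac v) L.toLinearMap₁₂ f = fun x => 𝐞 (-L v x) • f v := by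
  ext x
  simp [fourierIntegral, integral_dirac]

lemma contDiff_wave (L : V →L[ℝ] Rn n →L[ℝ] ℝ) (f : V → ℂ) (v : V) :
    ContDiff ℝ ∞ fun x => 𝐞 (-L v x) • f v := by
  rw [← fourierIntegral_dirac]
  exact contDiff_fourierIntegral L fun l _ => integrable_dirac_moment f v l

lemma iteratedFDeriv_wave (L : V →L[ℝ] Rn n →L[ℝ] ℝ) (f : V → ℂ) (v : V) (l : ℕ) (x : Rn n) :
    iteratedFDeriv ℝ l (fun x => 𝐞 (-L v x) • f v) x =
      𝐞 (-L v x) • fourierPowSMulRight L f v l := by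
  rw [← fourierIntegral_dirac, iteratedFDeriv_fourierIntegral (N := ⊤) L
    (fun l _ => integrable_dirac_moment f v l) aestronglyMeasurable_dirac le_top]
  simp [fourierIntegral, integral_dirac]

lemma norm_iteratedFDeriv_wave_le (L : V →L[ℝ] Rn n →L[ℝ] ℝ) (f : V → ℂ) (v : V) (l : ℕ)
    (x : Rn n) : ‖iteratedFDeriv ℝ l (fun x => 𝐞 (-L v x) • f v) x‖ ≤
      (2 * π * ‖L‖) ^ l * (‖v‖ ^ l * ‖f v‖) := by
  rw [iteratedFDeriv_wave, Circle.norm_smul, ← mul_assoc]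
  exact norm_fourierPowSMulRight_le L f v l

lemma continuous_iteratedFDeriv_wave (L : V →L[ℝ] Rn n →L[ℝ] ℝ) {f : V → ℂ} (hf : Continuous f)
    (l : ℕ) : Continuous fun q : V × Rn n =>
      iteratedFDeriv ℝ l (fun x => 𝐞 (-L q.1 x) • f q.1) q.2 := by
  simp only [iteratedFDeriv_wave]
  exact (continuous_fourierChar.comp (by fun_prop)).smul
    ((hf.fourierPowSMulRight L l).comp continuous_fst)

/-- The real part of the plane wave `f(v) e^{-2πi L(v, x)}` as a function of `x`. -/
def waveRe (L : V →L[ℝ] Rn n →L[ℝ] ℝ) (f : V → ℂ) (v : V) : smoothFunctions n :=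
  ⟨fun x => (𝐞 (-L v x) • f v).re, Complex.reCLM.contDiff.comp (contDiff_wave L f v)⟩

/-- The real part of the Fourier transform of `f`, for `f` with all moments finite. -/
def fourierRe (L : V →L[ℝ] Rn n →L[ℝ] ℝ) (μ : Measure V) (f : V → ℂ)
    (hf : ∀ l : ℕ, Integrable (fun v => ‖v‖ ^ l * ‖f v‖) μ) : smoothFunctions n :=
  ⟨fun x => (fourierIntegral 𝐞 μ L.toLinearMap₁₂ f x).re,
    Complex.reCLM.contDiff.comp (contDiff_fourierIntegral (N := ⊤) L fun l _ => hf l)⟩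

/-- Taking real parts of multilinear maps. -/
def reMultilinear (n l : ℕ) : (Rn n [×l]→L[ℝ] ℂ) →L[ℝ] MultilinearForms n l :=
  ContinuousLinearMap.compContinuousMultilinearMapL ℝ (fun _ : Fin l => Rn n) ℂ ℝ Complex.reCLM

lemma formDeriv_re {φ : Rn n → ℂ} (hφ : ContDiff ℝ ∞ φ) (l : ℕ) (x : Rn n) :
    formDeriv l (fun x => (φ x).re) x = reMultilinear n l (iteratedFDeriv ℝ l φ x) :=
  Complex.reCLM.iteratedFDeriv_comp_left hφ.contDiffAt (by exact_mod_cast le_top)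

lemma continuous_formDeriv_waveRe (L : V →L[ℝ] Rn n →L[ℝ] ℝ) {f : V → ℂ} (hf : Continuous f)
    (l : ℕ) : Continuous fun q : V × Rn n => formDeriv l (waveRe L f q.1 : Rn n → ℝ) q.2 :=
  ((reMultilinear n l).continuous.comp (continuous_iteratedFDeriv_wave L hf l)).congr fun q =>
    (formDeriv_re (contDiff_wave L f q.1) l q.2).symm

lemma norm_formDeriv_waveRe_le (L : V →L[ℝ] Rn n →L[ℝ] ℝ) (f : V → ℂ) (l : ℕ) (v : V)
    (x : Rn n) : ‖formDeriv l (waveRe L f v : Rn n → ℝ) x‖ ≤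
      ‖reMultilinear n l‖ * ((2 * π * ‖L‖) ^ l * (‖v‖ ^ l * ‖f v‖)) := by
  refine (congrArg norm (formDeriv_re (contDiff_wave L f v) l x)).trans_le ?_
  exact (reMultilinear n l).le_opNorm_of_le (norm_iteratedFDeriv_wave_le L f v l x)

lemma formDeriv_fourierRe (L : V →L[ℝ] Rn n →L[ℝ] ℝ) {μ : Measure V} {f : V → ℂ}
    (hf : Continuous f) (hI : ∀ l : ℕ, Integrable (fun v => ‖v‖ ^ l * ‖f v‖) μ) (l : ℕ)
    (x : Rn n) : formDeriv l (fourierRe L μ f hI : Rn n → ℝ) x =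
      ∫ v, formDeriv l (waveRe L f v : Rn n → ℝ) x ∂μ := by
  have hint : Integrable (fun v => iteratedFDeriv ℝ l (fun x => 𝐞 (-L v x) • f v) x) μ :=
    ((hI l).const_mul ((2 * π * ‖L‖) ^ l)).mono'
      ((continuous_iteratedFDeriv_wave L hf l).comp
        (Continuous.prodMk_left x)).aestronglyMeasurable
      (.of_forall fun v => norm_iteratedFDeriv_wave_le L f v l x)
  have hwave (v : V) : formDeriv l (waveRe L f v : Rn n → ℝ) x =
      reMultilinear n l (iteratedFDeriv ℝ l (fun x => 𝐞 (-L v x) • f v) x) :=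
    formDeriv_re (contDiff_wave L f v) l x
  simp only [hwave]
  rw [(reMultilinear n l).integral_comp_comm hint]
  refine (formDeriv_re (contDiff_fourierIntegral (N := ⊤) L fun l _ => hI l) l x).trans ?_
  rw [iteratedFDeriv_fourierIntegral (N := ⊤) L (fun l _ => hI l) hf.aestronglyMeasurable le_top]
  simp only [iteratedFDeriv_wave]
  rfl

lemma apply_fourierRe (u : compactDistributions 𝕜 n) (L : V →L[ℝ] Rn n →L[ℝ] ℝ) {μ : Measure V}
    {f : V → ℂ} (hf : Continuous f) (hI : ∀ l : ℕ, Integrable (fun v => ‖v‖ ^ l * ‖f v‖) μ) :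
    u.1 (fourierRe L μ f hI) = ∫ v, u.1 (waveRe L f v) ∂μ :=
  apply_eq_integral_apply u _ (continuous_formDeriv_waveRe L hf)
    (fun l => ((hI l).const_mul _).const_mul _) (norm_formDeriv_waveRe_le L f)
    (formDeriv_fourierRe L hf hI)

lemma continuous_apply_waveRe (u : compactDistributions 𝕜 n) (L : V →L[ℝ] Rn n →L[ℝ] ℝ)
    {f : V → ℂ} (hf : Continuous f) : Continuous fun v => u.1 (waveRe L f v) :=
  continuous_apply_of_continuous_formDeriv u (continuous_formDeriv_waveRe L hf)

lemma eq_zero_of_forall_apply_waveRe_eq_zero {u : compactDistributions 𝕜 n}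
    (hu : ∀ (f : Rn n → ℂ) (η : Rn n), u.1 (waveRe (innerSL ℝ) f η) = 0) : u = 0 := by
  obtain ⟨R, hR, hloc⟩ := exists_apply_eq_of_eqOn_ball u
  refine Subtype.ext (LinearMap.ext fun φ => ?_)
  let χ : ContDiffBump (0 : Rn n) := ⟨R, R + 1, hR, lt_add_one R⟩
  have hc : HasCompactSupport fun x => ((χ x * (φ : Rn n → ℝ) x : ℝ) : ℂ) :=
    (χ.hasCompactSupport.mul_right (f' := (φ : Rn n → ℝ))).comp_left Complex.ofReal_zero
  have hs : ContDiff ℝ ∞ fun x => ((χ x * (φ : Rn n → ℝ) x : ℝ) : ℂ) :=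
    Complex.ofRealCLM.contDiff.comp (χ.contDiff.mul (smoothFunctions_contDiff φ))
  let Φ : SchwartzMap (Rn n) ℂ := hc.toSchwartzMap hs
  let g : SchwartzMap (Rn n) ℂ := 𝓕⁻ Φ
  have hzero := apply_fourierRe u (innerSL ℝ) (μ := volume) g.continuous
    fun l => g.integrable_pow_mul volume l
  simp only [hu, integral_zero] at hzero
  refine (hloc _ _ fun x hx => ?_).trans hzero
  have hinv : 𝓕 (g : Rn n → ℂ) x = Φ x := by
    rw [← SchwartzMap.fourier_coe]
    simp [g]
  change _ = (𝓕 (g : Rn n → ℂ) x).re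
  rw [hinv]
  change _ = ((χ x * (φ : Rn n → ℝ) x : ℝ) : ℂ).re
  rw [Complex.ofReal_re, χ.one_of_mem_closedBall (Metric.ball_subset_closedBall hx), one_mul]

end PlaneWaves

section LineCutoffs

open scoped InnerProductSpace

variable {n : ℕ}

/-- A smooth bump function on `ℝ` with integral `1`, supported in `[-2, 2]`. -/
def unitBump : ℝ → ℝ := (⟨1, 2, one_pos, one_lt_two⟩ : ContDiffBump (0 : ℝ)).normed volume

lemma unitBump_contDiff : ContDiff ℝ ∞ unitBump := ContDiffBump.contDiff_normed _

lemma integral_unitBump : ∫ t, unitBump t = 1 := ContDiffBump.integral_normed _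

lemma unitBump_eq_zero {t : ℝ} (ht : 2 ≤ |t|) : unitBump t = 0 := by
  rw [← Function.notMem_support, unitBump, ContDiffBump.support_normed_eq]
  simpa using ht

/-- A weight on pairs `(x, ξ)` of a point and a direction, with integral `1` along every line. -/
def lineWeight (q : Rn n × Rn n) : ℝ := ‖q.2‖ ^ 2 * unitBump ⟪q.1, q.2⟫_ℝ

lemma lineWeight_contDiff : ContDiff ℝ ∞ (lineWeight (n := n)) :=
  (contDiff_snd.norm_sq ℝ).mul (unitBump_contDiff.comp (contDiff_fst.inner ℝ contDiff_snd))

lemma integral_lineWeight (x : Rn n) {ξ : Rn n} (hξ : ξ ≠ 0) :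
    ∫ t : ℝ, lineWeight (x - t • ξ, ξ) = 1 := by
  have hinner (t : ℝ) : ⟪x - t • ξ, ξ⟫_ℝ = ⟪x, ξ⟫_ℝ - ‖ξ‖ ^ 2 * t := by
    rw [inner_sub_left, real_inner_smul_left, real_inner_self_eq_norm_sq, mul_comm]
  simp only [lineWeight, hinner]
  rw [integral_const_mul, Measure.integral_comp_mul_left (fun s => unitBump (⟪x, ξ⟫_ℝ - s)),
    integral_sub_left_eq_self, integral_unitBump, smul_eq_mul, mul_one,
    abs_of_nonneg (by positivity), mul_inv_cancel₀ (by positivity)]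

/-- `‖ξ‖²` times the squared distance from the origin of the line through `x` in direction `ξ`. -/
def lineDistSq (q : Rn n × Rn n) : ℝ := ‖q.1‖ ^ 2 * ‖q.2‖ ^ 2 - ⟪q.1, q.2⟫_ℝ ^ 2

lemma lineDistSq_contDiff : ContDiff ℝ ∞ (lineDistSq (n := n)) :=
  ((contDiff_fst.norm_sq ℝ).mul (contDiff_snd.norm_sq ℝ)).sub
    ((contDiff_fst.inner ℝ contDiff_snd).pow 2)

lemma lineDistSq_sub_smul (x ξ : Rn n) (t : ℝ) :
    lineDistSq (x - t • ξ, ξ) = lineDistSq (x, ξ) := by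
  simp only [lineDistSq]
  rw [norm_sub_sq_real, inner_sub_left, real_inner_smul_left, real_inner_smul_right,
    real_inner_self_eq_norm_sq, norm_smul, Real.norm_eq_abs, mul_pow, sq_abs]
  ring

lemma lineDistSq_nonneg (q : Rn n × Rn n) : 0 ≤ lineDistSq q := by
  rw [lineDistSq, sub_nonneg, ← mul_pow, ← sq_abs]
  gcongr
  exact abs_real_inner_le_norm _ _

lemma lineDistSq_le (q : Rn n × Rn n) : lineDistSq q ≤ (‖q.1‖ * ‖q.2‖) ^ 2 := by
  rw [lineDistSq, ← mul_pow]
  exact sub_le_self _ (sq_nonneg _)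

lemma isCompact_setOf_inner_le_lineDistSq_le {C : Set (Rn n)} (hC : IsCompact C) (h0 : C ⊆ {0}ᶜ)
    (a b : ℝ) : IsCompact {q : Rn n × Rn n | q.2 ∈ C ∧ |⟪q.1, q.2⟫_ℝ| ≤ a ∧ lineDistSq q ≤ b} := by
  have hpos : ∀ ξ ∈ C, (0 : ℝ) < ‖ξ‖ := fun ξ hξ => norm_pos_iff.2 (h0 hξ)
  obtain ⟨δ, hδ, hδC⟩ := hC.exists_forall_le' continuous_norm.continuousOn hpos
  have hclosed : IsClosed {q : Rn n × Rn n | |⟪q.1, q.2⟫_ℝ| ≤ a ∧ lineDistSq q ≤ b} :=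
    IsClosed.and (isClosed_le (by fun_prop) continuous_const)
      (isClosed_le lineDistSq_contDiff.continuous continuous_const)
  refine ((isCompact_closedBall (0 : Rn n) (√((a ^ 2 + b) / δ ^ 2))).prod hC).of_isClosed_subset
    ((hC.isClosed.preimage continuous_snd).inter hclosed) ?_
  rintro ⟨x, ξ⟩ ⟨hξ, ha, hb⟩
  refine ⟨mem_closedBall_zero_iff.2 (Real.le_sqrt_of_sq_le ?_), hξ⟩
  rw [le_div_iff₀ (by positivity)]
  calc ‖x‖ ^ 2 * δ ^ 2 ≤ ‖x‖ ^ 2 * ‖ξ‖ ^ 2 := by gcongr; exact hδC ξ hξ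
    _ = |⟪x, ξ⟫_ℝ| ^ 2 + lineDistSq (x, ξ) := by rw [lineDistSq, sq_abs]; ring
    _ ≤ a ^ 2 + b := by gcongr

lemma exists_testFunction_eqOn {h : Rn n × Rn n → ℝ} (hh : ContDiff ℝ ∞ h) {C : Set (Rn n)}
    (hC : IsCompact C) (h0 : C ⊆ {0}ᶜ) (hhC : ∀ q, q.2 ∉ C → h q = 0) {a : ℝ} (ha : 0 < a) :
    ∃ ψ : 𝓓(phaseSpace n, ℝ), ∀ q, (q.2 ∈ C → lineDistSq q ≤ a) →
      ψ q = h q * lineWeight q := by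
  let γ : ContDiffBump (0 : ℝ) := ⟨a, a + 1, ha, lt_add_one a⟩
  let K : Set (Rn n × Rn n) := {q | q.2 ∈ C ∧ |⟪q.1, q.2⟫_ℝ| ≤ 2 ∧ lineDistSq q ≤ a + 1}
  have hK : IsCompact K := isCompact_setOf_inner_le_lineDistSq_le hC h0 2 (a + 1)
  have hzero (q) (hq : q ∉ K) : h q * lineWeight q * γ (lineDistSq q) = 0 := by
    contrapose! hq
    refine ⟨by_contra fun hqC => hq ?_, ?_, ?_⟩
    · rw [hhC q hqC, zero_mul, zero_mul]
    · contrapose! hq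
      rw [lineWeight, unitBump_eq_zero hq.le, mul_zero, mul_zero, zero_mul]
    · contrapose! hq
      rw [γ.zero_of_le_dist, mul_zero]
      simpa [abs_of_nonneg (lineDistSq_nonneg q)] using hq.le
  refine ⟨⟨fun q => h q * lineWeight q * γ (lineDistSq q),
    (hh.mul lineWeight_contDiff).mul (γ.contDiff.comp lineDistSq_contDiff),
    .intro hK hzero, fun q hq => ?_⟩, fun q hq => ?_⟩
  · exact h0 (closure_minimal (Function.support_subset_iff'.2 hzero) hK.isClosed hq).1
  · change h q * lineWeight q * γ (lineDistSq q) = _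
    by_cases hqC : q.2 ∈ C
    · rw [γ.one_of_mem_closedBall, mul_one]
      simpa [abs_of_nonneg (lineDistSq_nonneg q)] using hq hqC
    · rw [hhC q hqC, zero_mul, zero_mul]

lemma exists_adjoint_eq_integral {h : Rn n × Rn n → ℝ} (hh : ContDiff ℝ ∞ h)
    (hline : ∀ (x ξ : Rn n) (t : ℝ), h (x - t • ξ, ξ) = h (x, ξ))
    {C : Set (Rn n)} (hC : IsCompact C)
    (h0 : C ⊆ {0}ᶜ) (hhC : ∀ q, q.2 ∉ C → h q = 0) (R : ℝ) :
    ∃ ψ : 𝓓(phaseSpace n, ℝ), ∀ x ∈ Metric.ball (0 : Rn n) R,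
      (adjoint 0 ![] ψ : Rn n → ℝ) x = ∫ ξ, h (x, ξ) := by
  obtain ⟨ρ, hρ⟩ := hC.isBounded.exists_norm_le
  obtain ⟨ψ, hψ⟩ := exists_testFunction_eqOn hh hC h0 hhC
    (by positivity : 0 < (R * ρ) ^ 2 + 1)
  refine ⟨ψ, fun x hx => ?_⟩
  change ∫ ξ : Rn n, ∫ t : ℝ, t ^ 0 * monomial ![] ξ * ψ (x - t • ξ, ξ) = _
  congr 1; ext ξ
  have hψh (t : ℝ) : ψ (x - t • ξ, ξ) = h (x, ξ) * lineWeight (x - t • ξ, ξ) := by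
    rw [← hline x ξ t]
    refine hψ _ fun hξ => ?_
    rw [lineDistSq_sub_smul]
    refine (lineDistSq_le _).trans (le_add_of_le_of_nonneg ?_ zero_le_one)
    have hxR : ‖x‖ ≤ R := (mem_ball_zero_iff.1 hx).le
    have hξρ : ‖ξ‖ ≤ ρ := hρ ξ hξ
    dsimp only
    gcongr
    exact (norm_nonneg x).trans hxR
  by_cases hξ : ξ ∈ C
  · simp [hψh, monomial, integral_const_mul, integral_lineWeight x (h0 hξ)]
  · simp [hψh, hhC (x, ξ) hξ]

end LineCutoffs

section Injectivity

open VectorFourier Real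
open scoped FourierTransform InnerProductSpace

variable {𝕜 : Type*} [RCLike 𝕜] {n : ℕ}

lemma contDiff_wave_uncurry (L : Rn n →L[ℝ] Rn n →L[ℝ] ℝ) :
    ContDiff ℝ ∞ fun q : Rn n × Rn n => (𝐞 (-L q.2 q.1) : ℂ) := by
  simp only [fourierChar_apply]
  have hphase : ContDiff ℝ ∞ fun q : Rn n × Rn n => 2 * π * -L q.2 q.1 := by fun_prop
  exact ((Complex.ofRealCLM.contDiff.comp hphase).mul contDiff_const).cexp

lemma waveRe_apply (L : Rn n →L[ℝ] Rn n →L[ℝ] ℝ) (f : Rn n → ℂ) (ξ x : Rn n) :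
    (waveRe L f ξ : Rn n → ℝ) x = (𝐞 (-L ξ x) • f ξ).re := rfl

lemma fourierRe_apply (L : Rn n →L[ℝ] Rn n →L[ℝ] ℝ) {f : Rn n → ℂ} (hf : Continuous f)
    (hc : HasCompactSupport f) (hI : ∀ l : ℕ, Integrable (fun ξ => ‖ξ‖ ^ l * ‖f ξ‖)) (x : Rn n) :
    (fourierRe L volume f hI : Rn n → ℝ) x = ∫ ξ, (waveRe L f ξ : Rn n → ℝ) x := by
  have hint : Integrable fun ξ : Rn n => 𝐞 (-L ξ x) • f ξ :=
    Continuous.integrable_of_hasCompactSupport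
      ((continuous_fourierChar.comp (by fun_prop)).smul hf) hc.smul_left
  exact (Complex.reCLM.integral_comp_comm hint).symm

lemma integral_apply_waveRe_eq_zero {u : compactDistributions 𝕜 n}
    (hu : momentRay 0 (scalarTensor u) = 0) {L : Rn n →L[ℝ] Rn n →L[ℝ] ℝ}
    (hL : ∀ ξ, L ξ ξ = 0) {f : Rn n → ℂ} (hf : ContDiff ℝ ∞ f) (hc : HasCompactSupport f)
    (h0 : tsupport f ⊆ {0}ᶜ) : ∫ ξ, u.1 (waveRe L f ξ) = 0 := by
  have hI (l : ℕ) : Integrable fun ξ => ‖ξ‖ ^ l * ‖f ξ‖ :=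
    ((continuous_norm.pow l).mul hf.continuous.norm).integrable_of_hasCompactSupport
      hc.norm.mul_left
  obtain ⟨R, -, hlocal⟩ := exists_apply_eq_of_eqOn_ball u
  obtain ⟨ψ, hψ⟩ := exists_adjoint_eq_integral
    (h := fun q => (waveRe L f q.2 : Rn n → ℝ) q.1)
    (Complex.reCLM.contDiff.comp ((contDiff_wave_uncurry L).mul (hf.comp contDiff_snd)))
    (fun x ξ t => by simp [waveRe_apply, hL]) hc.isCompact h0
    (fun q hq => by simp [waveRe_apply, image_eq_zero_of_notMem_tsupport hq]) R
  rw [← apply_fourierRe u L hf.continuous hI, ← hlocal (adjoint 0 ![] ψ) _ fun x hx =>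
    (hψ x hx).trans (fourierRe_apply L hf.continuous hc hI x).symm]
  exact (momentRay_rank_zero_apply 0 (scalarTensor u) ψ).symm.trans
    (congrArg (fun T : 𝓓'(phaseSpace n, 𝕜) => T ψ) hu)

lemma waveRe_ofReal_mul (L : Rn n →L[ℝ] Rn n →L[ℝ] ℝ) (χ : Rn n → ℝ) (c : ℂ) (ξ : Rn n) :
    waveRe L (fun ξ => (χ ξ : ℂ) * c) ξ = χ ξ • waveRe L (fun _ => c) ξ := by
  ext x
  change (𝐞 (-L ξ x) • ((χ ξ : ℂ) * c)).re = χ ξ * (𝐞 (-L ξ x) • c).re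
  rw [Circle.smul_def, Circle.smul_def, smul_eq_mul, smul_eq_mul, mul_left_comm,
    Complex.re_ofReal_mul]

lemma apply_waveRe_eq_zero {u : compactDistributions 𝕜 n}
    (hu : momentRay 0 (scalarTensor u) = 0) {L : Rn n →L[ℝ] Rn n →L[ℝ] ℝ}
    (hL : ∀ ξ, L ξ ξ = 0) (c : ℂ) {ξ : Rn n} (hξ : ξ ≠ 0) :
    u.1 (waveRe L (fun _ => c) ξ) = 0 := by
  have hcont : Continuous fun ξ => u.1 (waveRe L (fun _ => c) ξ) :=
    continuous_apply_waveRe u L continuous_const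
  have hae : ∀ᵐ ξ : Rn n, ξ ∈ ({0}ᶜ : Set (Rn n)) → u.1 (waveRe L (fun _ => c) ξ) = 0 := by
    refine isOpen_compl_singleton.ae_eq_zero_of_integral_contDiff_smul_eq_zero
      (hcont.locallyIntegrable.locallyIntegrableOn _) fun χ hχ hc h0 => ?_
    simp only [← map_smul, ← waveRe_ofReal_mul]
    exact integral_apply_waveRe_eq_zero hu hL
      ((Complex.ofRealCLM.contDiff.comp hχ).mul contDiff_const)
      (hc.comp_left Complex.ofReal_zero).mul_right
      ((closure_mono (Function.support_subset_iff.2 fun _ h =>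
        Complex.ofReal_ne_zero.1 (left_ne_zero_of_mul h))).trans h0)
  exact Measure.eqOn_open_of_ae_eq ((ae_restrict_iff' (measurableSet_singleton 0).compl).2 hae)
    isOpen_compl_singleton hcont.continuousOn continuousOn_const hξ

lemma exists_ne_zero_inner_eq_zero (hn : 2 ≤ n) (η : Rn n) :
    ∃ ξ : Rn n, ξ ≠ 0 ∧ ⟪η, ξ⟫_ℝ = 0 := by
  have hrank : Module.finrank ℝ ℝ < Module.finrank ℝ (Rn n) := by
    rw [finrank_euclideanSpace_fin, Module.finrank_self]
    exact hn
  obtain ⟨ξ, hξ, hξ0⟩ := Submodule.exists_mem_ne_zero_of_ne_bot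
    (LinearMap.ker_ne_bot_of_finrank_lt (f := (innerSL ℝ η).toLinearMap) hrank)
  exact ⟨ξ, hξ0, hξ⟩

lemma apply_planeWave_eq_zero (hn : 2 ≤ n) {u : compactDistributions 𝕜 n}
    (hu : momentRay 0 (scalarTensor u) = 0) (f : Rn n → ℂ) (η : Rn n) :
    u.1 (waveRe (innerSL ℝ) f η) = 0 := by
  obtain ⟨ξ, hξ, hηξ⟩ := exists_ne_zero_inner_eq_zero hn η
  let L : Rn n →L[ℝ] Rn n →L[ℝ] ℝ := (‖ξ‖ ^ 2)⁻¹ •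
    ((innerSL ℝ ξ).smulRight (innerSL ℝ η) - (innerSL ℝ η).smulRight (innerSL ℝ ξ))
  have hL (ζ x : Rn n) : L ζ x = (‖ξ‖ ^ 2)⁻¹ * (⟪ξ, ζ⟫_ℝ * ⟪η, x⟫_ℝ - ⟪η, ζ⟫_ℝ * ⟪ξ, x⟫_ℝ) := by
    simp [L]
  have hLξ (x : Rn n) : L ξ x = ⟪η, x⟫_ℝ := by
    rw [hL, hηξ, real_inner_self_eq_norm_sq, zero_mul, sub_zero,
      inv_mul_cancel_left₀ (by positivity)]
  have hwave : waveRe (innerSL ℝ) f η = waveRe L (fun _ => f η) ξ := by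
    ext x
    rw [waveRe_apply, waveRe_apply, hLξ, innerSL_apply_apply]
  rw [hwave]
  exact apply_waveRe_eq_zero hu (fun ζ => by rw [hL]; ring) (f η) hξ

theorem eq_zero_of_momentRay_eq_zero (hn : 2 ≤ n) {u : compactDistributions 𝕜 n}
    (hu : momentRay 0 (scalarTensor u) = 0) : u = 0 :=
  eq_zero_of_forall_apply_waveRe_eq_zero (apply_planeWave_eq_zero hn hu)

theorem eq_zero_of_genMomentRay_eq_zero (hn : 2 ≤ n) {m : ℕ} (F : TensorSums 𝕜 n m) (j : ℕ)
    (hj : j ≤ m) (hF : ∀ k ≤ j, genMomentRay k F = 0) : F ⟨j, Nat.lt_succ_of_le hj⟩ = 0 := by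
  refine Subtype.ext (funext fun i => eq_zero_of_momentRay_eq_zero hn ?_)
  rw [momentRay_component_eq F j hj i]
  simp only [symmetrize, altDeriv_eq_zero hF, eulerOp_zero, Finset.sum_const_zero]
  exact (congrArg _ (smul_zero _)).trans (smul_zero _)

end Injectivity

end MomentumRay

end

theorem mainTheorem4_general {𝕜 : Type*} [RCLike 𝕜] (n m : ℕ) (F : TensorSums 𝕜 n m) :
    (∀ (j : ℕ) (hj : j ≤ m) (i : Fin j → Fin n),
      momentRay 0 (scalarTensor ((F ⟨j, Nat.lt_succ_of_le hj⟩).1 i)) =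
        ((-1 : ℝ) ^ (m - j) / ((m - j).factorial * j.factorial)) •
          symmetrize (fun i' : Fin j → Fin n =>
            eulerOp (m - j) (∑ k ∈ Finset.range (j + 1),
              ((-1 : ℝ) ^ k * (j.choose k : ℝ)) • mixedDeriv k i' (genMomentRay k F))) i) ∧
    (2 ≤ n → ∀ (j : ℕ) (hj : j ≤ m), (∀ l ≤ j, genMomentRay l F = 0) →
      F ⟨j, Nat.lt_succ_of_le hj⟩ = 0) :=
  ⟨momentRay_component_eq F, fun hn => eq_zero_of_genMomentRay_eq_zero hn F⟩

theorem mainTheorem4 {𝕜 : Type*} [RCLike 𝕜] (n m : ℕ) (F : TensorSums 𝕜 n m) :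
    (∀ (j : ℕ) (hj : j ≤ m) (i : Fin j → Fin n),
      momentRay 0 (scalarTensor ((F ⟨j, Nat.lt_succ_of_le hj⟩).1 i)) =
        ((-1 : ℝ) ^ (m - j) / ((m - j).factorial * j.factorial)) •
          symmetrize (fun i' : Fin j → Fin n =>
            eulerOp (m - j) (∑ k ∈ Finset.range (j + 1),
              ((-1 : ℝ) ^ k * (j.choose k : ℝ)) • mixedDeriv k i' (genMomentRay k F))) i) ∧
    (2 ≤ n → ∀ (k : ℕ) (hk : k < m), (∀ l ≤ k, genMomentRay l F = 0) →
      ∀ (j : ℕ) (hj : j ≤ k), F ⟨j, Nat.lt_succ_of_le (hj.trans hk.le)⟩ = 0) :=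
  ⟨(mainTheorem4_general n m F).1, fun hn _ hk hF j hj =>
    (mainTheorem4_general n m F).2 hn j (hj.trans hk.le) fun l hl => hF l (hl.trans hj)⟩
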